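/- **Optimal algorithm in the supervised multitask Gaussian mixture.** Let $T\ge 1$, let $C$ be a real positive semidefinite $T\times T$ matrix with unit diagonal, and let $\sigma_s>0$, $\alpha_s>0$ for $s=1,\dots,T$. For each dimension $D\ge T$ let $N_s=N_s(D)$ be integers with $N_s/D\to\alpha_s$ as $D\to\infty$. The centers $U_1,\dots,U_T$ are uniform on the unit sphere of $\mathbb R^D$ conditioned on $\langle U_s,U_{s'}\rangle=C_{ss'}$ for all $s\ne s'$ (that is, $(U_1,\dots,U_T)$ has the rotation-invariant law on the $T$-tuples with Gram matrix $C$). The data are $$Y_{si}=V_{si}U_s+\sigma_sZ_{si},\qquad 1\le s\le T,\ 1\le i\le N_s,$$ with $V_{si}$ i.i.d. uniform on $\{-1,1\}$, $Z_{si}$ i.i.d. $\mathcal N(0,I_D)$, and $U,V,Z$ independent. All tasks are fully labeled: both the $Y_{si}$ and the $V_{si}$ are observed. Fix a task $t$ and let $Y_{\rm new}=V_{\rm new}U_t+\sigma_tZ_{\rm new}$ be a new point, with $V_{\rm new}$ uniform on $\{-1,1\}$ and $Z_{\rm new}\sim\mathcal N(0,I_D)$ independent of each other and of everything else. The Bayes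 risk of task $t$ is $R_{t,D}=\inf_{\hat V}\mathbb P(\hat V\ne V_{\rm new})$, the infimum over all (measurable) estimators $\hat V$ based on $(V_{si})$, $(Y_{si})$ and $Y_{\rm new}$, which may also depend on the parameters of the model. Put $M=\big(C_{ss'}/(\sigma_s\sigma_{s'})\big)_{s,s'}$, $D_\alpha=\mathrm{diag}(\alpha_1,\dots,\alpha_T)$, $A=(a_{ss'})=MD_\alpha(I+MD_\alpha)^{-1}$, $$\bar Y_s=\frac1{N_s}\sum_{i=1}^{N_s}V_{si}Y_{si},\qquad \tilde Y_t=\sum_{s=1}^T a_{ts}\,\sigma_s^{-1}\bar Y_s,\qquad \hat V^{*}_{\rm new}=\operatorname{sgn}\langle Y_{\rm new},\tilde Y_t\rangle .$$ Then $\hat V^*_{\rm new}$ asymptotically attains the Bayes risk of task $t$: as $D\to\infty$ both $R_{t,D}$ and $\mathbb P(\hat V^*_{\rm new}\ne V_{\rm new})$ converge to $$1-\Phi(\sqrt{q_t}),\qquad q_t=\big[M-M(I+D_\alpha M)^{-1}\big]_{tt},$$ where $\Phi$ is the distribution function of $\mathcal N(0,1)$. -/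

import Mathlib

open MeasureTheory ProbabilityTheory Filter Topology
open scoped Matrix MatrixOrder

noncomputable section

namespace MultitaskGM

/-- The ambient Euclidean space `ℝ^D`. -/
abbrev Pt (D : ℕ) : Type := EuclideanSpace ℝ (Fin D)

/-! ### The prior of the class centers -/

/-- Orthonormalise `g_1, …, g_T` by the Gram-Schmidt process and mix the resulting orthonormal
vectors with `C^{1/2}`: for linearly independent `g` the result has Gram matrix `C`
(see `inner_centers`). -/
def centers {T D : ℕ} (C : Matrix (Fin T) (Fin T) ℝ) (g : Fin T → Pt D) : Fin T → Pt D :=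
  fun s => ∑ r, CFC.sqrt C r s • InnerProductSpace.gramSchmidtNormed ℝ g r

theorem inner_centers {T D : ℕ} {C : Matrix (Fin T) (Fin T) ℝ} (hC : C.PosSemidef)
    {g : Fin T → Pt D} (hg : LinearIndependent ℝ g) (s s' : Fin T) :
    inner ℝ (centers C g s) (centers C g s') = C s s' := by
  have ho := InnerProductSpace.gramSchmidtNormed_orthonormal hg
  have h2 : CFC.sqrt C * CFC.sqrt C = C := CFC.sqrt_mul_sqrt_self C hC.nonneg
  have hs : (CFC.sqrt C).IsHermitian := (Matrix.nonneg_iff_posSemidef.1 (CFC.sqrt_nonneg C)).1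
  unfold centers
  rw [ho.inner_sum]
  conv_rhs => rw [← h2, Matrix.mul_apply]
  refine Finset.sum_congr rfl fun r _ => ?_
  have := hs.apply r s
  simp at this ⊢
  left; exact this.symm

theorem measurable_gramSchmidt {T D : ℕ} (n : Fin T) :
    Measurable fun g : Fin T → Pt D => InnerProductSpace.gramSchmidt ℝ g n := by
  induction n using WellFoundedLT.induction with
  | ind n ih =>
    have h : (fun g : Fin T → Pt D => InnerProductSpace.gramSchmidt ℝ g n) = fun g =>
        g n - ∑ i ∈ Finset.Iio n,
          (inner ℝ (InnerProductSpace.gramSchmidt ℝ g i) (g n) /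
            ‖InnerProductSpace.gramSchmidt ℝ g i‖ ^ 2) • InnerProductSpace.gramSchmidt ℝ g i := by
      funext g
      exact eq_sub_of_add_eq (InnerProductSpace.gramSchmidt_def'' ℝ g n).symm
    rw [h]
    refine (measurable_pi_apply n).sub (Finset.measurable_fun_sum _ fun i hi => ?_)
    have hi' := ih i (Finset.mem_Iio.1 hi)
    exact ((hi'.inner (measurable_pi_apply n)).div (hi'.norm.pow_const 2)).smul hi'

theorem measurable_centers {T D : ℕ} (C : Matrix (Fin T) (Fin T) ℝ) :
    Measurable (centers C : (Fin T → Pt D) → Fin T → Pt D) := by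
  refine measurable_pi_lambda _ fun s => Finset.measurable_fun_sum _ fun r _ => ?_
  have h := measurable_gramSchmidt (D := D) r
  have h' : Measurable fun g : Fin T → Pt D => InnerProductSpace.gramSchmidtNormed ℝ g r := by
    unfold InnerProductSpace.gramSchmidtNormed
    exact h.norm.inv.smul h
  exact h'.const_smul (CFC.sqrt C r s)

/-- The law of the centers `U_1, …, U_T`: uniform on the unit sphere of `ℝ^D`, conditioned on
having Gram matrix `C`.  For `T ≤ D` this is the unique rotation-invariant probability measure on
the tuples with Gram matrix `C`; it is obtained by applying `centers C` to independent standard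
Gaussian vectors (which are almost surely linearly independent). -/
def centerLaw {T : ℕ} (C : Matrix (Fin T) (Fin T) ℝ) (D : ℕ) : Measure (Fin T → Pt D) :=
  (Measure.pi fun _ : Fin T => stdGaussian (Pt D)).map (centers C)

instance {T : ℕ} (C : Matrix (Fin T) (Fin T) ℝ) (D : ℕ) : IsProbabilityMeasure (centerLaw C D) :=
  Measure.isProbabilityMeasure_map (measurable_centers C).aemeasurable

/-! ### The multitask Gaussian mixture model -/

/-- One outcome of the experiment with `n s` training points in task `s` and one new point. -/
structure Outcome (T : ℕ) (n : Fin T → ℕ) (D : ℕ) where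
  /-- the classes `V_{si} ∈ {-1, 1}` of the training points -/
  V : ∀ s, Fin (n s) → ℝ
  /-- the centers `U_s` -/
  U : Fin T → Pt D
  /-- the noise vectors `Z_{si}` of the training points -/
  Z : ∀ s, Fin (n s) → Pt D
  /-- the class of the new point -/
  Vnew : ℝ
  /-- the noise vector of the new point -/
  Znew : Pt D

/-- The uniform law on `{-1, 1}`. -/
def classLaw : Measure ℝ := uniformOn {-1, 1}

/-- The joint law of `(V, U, Z, V_new, Z_new)`: all independent, the classes uniform on `{-1, 1}`,
the noise vectors standard Gaussian, and the centers distributed according to `centerLaw C D`. -/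
def modelLaw {T : ℕ} (C : Matrix (Fin T) (Fin T) ℝ) (n : Fin T → ℕ) (D : ℕ) :
    Measure ((∀ s, Fin (n s) → ℝ) × (Fin T → Pt D) × (∀ s, Fin (n s) → Pt D) × ℝ × Pt D) :=
  (Measure.pi fun s => Measure.pi fun _ : Fin (n s) => classLaw).prod <|
    (centerLaw C D).prod <|
    (Measure.pi fun s => Measure.pi fun _ : Fin (n s) => stdGaussian (Pt D)).prod <|
    classLaw.prod (stdGaussian (Pt D))

/-- Read a point of the sample space as an outcome. -/
def toOutcome {T : ℕ} {n : Fin T → ℕ} {D : ℕ}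
    (ω : (∀ s, Fin (n s) → ℝ) × (Fin T → Pt D) × (∀ s, Fin (n s) → Pt D) × ℝ × Pt D) :
    Outcome T n D :=
  ⟨ω.1, ω.2.1, ω.2.2.1, ω.2.2.2.1, ω.2.2.2.2⟩

/-- The training points `Y_{si} = V_{si} U_s + σ_s Z_{si}`. -/
def Outcome.Y {T : ℕ} {n : Fin T → ℕ} {D : ℕ} (o : Outcome T n D) (σ : Fin T → ℝ) :
    ∀ s, Fin (n s) → Pt D :=
  fun s i => o.V s i • o.U s + σ s • o.Z s i

/-- The new point of task `t`, `Y_new = V_new U_t + σ_t Z_new`. -/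
def Outcome.Ynew {T : ℕ} {n : Fin T → ℕ} {D : ℕ} (o : Outcome T n D) (σ : Fin T → ℝ)
    (t : Fin T) : Pt D :=
  o.Vnew • o.U t + σ t • o.Znew

/-- What the statistician observes when every task is fully labeled: all classes and all points of
the training set, and the new point. -/
abbrev Obs (T : ℕ) (n : Fin T → ℕ) (D : ℕ) : Type :=
  (∀ s, Fin (n s) → ℝ) × (∀ s, Fin (n s) → Pt D) × Pt D

/-- The probability `P(V̂ ≠ V_new)` that the classifier `f` misclassifies a new point of
task `t`. -/
def risk {T : ℕ} (C : Matrix (Fin T) (Fin T) ℝ) (σ : Fin T → ℝ) (n : Fin T → ℕ) (D : ℕ)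
    (t : Fin T) (f : Obs T n D → ℝ) : ℝ :=
  (modelLaw C n D).real
    {ω | f ((toOutcome ω).V, (toOutcome ω).Y σ, (toOutcome ω).Ynew σ t) ≠ (toOutcome ω).Vnew}

/-- The Bayes risk of task `t`: the infimum of the misclassification probability over all
estimators of `V_new`.  The estimator may depend on all the parameters of the model. -/
def bayesRisk {T : ℕ} (C : Matrix (Fin T) (Fin T) ℝ) (σ : Fin T → ℝ) (n : Fin T → ℕ) (D : ℕ)
    (t : Fin T) : ℝ :=
  ⨅ f : {f : Obs T n D → ℝ // Measurable f}, risk C σ n D t f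

/-! ### The algorithm -/

/-- The matrix `M = (C_{ss'} / (σ_s σ_{s'}))`. -/
def signalMatrix {T : ℕ} (C : Matrix (Fin T) (Fin T) ℝ) (σ : Fin T → ℝ) :
    Matrix (Fin T) (Fin T) ℝ :=
  Matrix.of fun s s' => C s s' / (σ s * σ s')

/-- The weights `A = M D_α (I + M D_α)⁻¹`. -/
def weights {T : ℕ} (C : Matrix (Fin T) (Fin T) ℝ) (σ α : Fin T → ℝ) :
    Matrix (Fin T) (Fin T) ℝ :=
  signalMatrix C σ * Matrix.diagonal α * (1 + signalMatrix C σ * Matrix.diagonal α)⁻¹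

/-- The class-weighted mean `Ȳ_s = n_s⁻¹ ∑_i v_{si} y_{si}` of task `s`. -/
def classMean {T : ℕ} {n : Fin T → ℕ} {D : ℕ} (v : ∀ s, Fin (n s) → ℝ)
    (y : ∀ s, Fin (n s) → Pt D) (s : Fin T) : Pt D :=
  (n s : ℝ)⁻¹ • ∑ i, v s i • y s i

/-- The combined mean `Ỹ_t = ∑_s a_{ts} σ_s⁻¹ Ȳ_s` of task `t`. -/
def combinedMean {T : ℕ} {n : Fin T → ℕ} {D : ℕ} (C : Matrix (Fin T) (Fin T) ℝ)
    (σ α : Fin T → ℝ) (v : ∀ s, Fin (n s) → ℝ) (y : ∀ s, Fin (n s) → Pt D) (t : Fin T) : Pt D :=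
  ∑ s, weights C σ α t s • (σ s)⁻¹ • classMean v y s

/-- The classifier `sgn ⟨Y_new, Ỹ_t⟩`. -/
def algorithm {T : ℕ} (C : Matrix (Fin T) (Fin T) ℝ) (σ α : Fin T → ℝ) (n : Fin T → ℕ) (D : ℕ)
    (t : Fin T) : Obs T n D → ℝ :=
  fun x => Real.sign (inner ℝ x.2.2 (combinedMean C σ α x.1 x.2.1 t))

/-- The overlap `q_t = [M - M (I + D_α M)⁻¹]_{tt}` of the fully labeled model. -/
def overlap {T : ℕ} (C : Matrix (Fin T) (Fin T) ℝ) (σ α : Fin T → ℝ) (t : Fin T) : ℝ :=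
  (signalMatrix C σ - signalMatrix C σ * (1 + Matrix.diagonal α * signalMatrix C σ)⁻¹) t t

end MultitaskGM

end

/-!
The Bayes risk is bounded below, in every dimension, by the error of an oracle, and the oracle's
error and the error of the algorithm converge to the same limit.

*Lower bound.*  Write `Ȳ` for the tuple of class means and `S` for its span.  By the Cameron-Martin
formula (`lintegral_noise_add`) the likelihood of the training data depends on the centers only
through their lengths and their inner products with the class means, and the law of the centers is
rotation invariant.  Hence, given the training data, the centers may be replaced by their mirror
images under the reflection `R` that fixes `S` (`lintegral_likelihood_oracleError_le`).  A
classifier of the new point must then tell the mean `U_t` of class `1` from the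
mean `-R U_t` of class `-1`.  These differ by twice the projection of `U_t` onto `S`, and by the
Neyman-Pearson lemma for two translated Gaussians (`two_mul_gaussianTail_le_of_disjoint`) the error
is at least `1 - Φ(‖P_S U_t‖ / σ_t)`.  No posterior has to be computed, and this bound depends only
on the inner products among `U_t` and the class means.

*Upper bound.*  Given the centers and the training data, the classifier `sgn ⟪Y_new, w⟫` errs with
probability `1 - Φ(⟪U_t, w⟫ / (σ_t ‖w‖))` (`newError_sign`).

*Limits.*  Jointly with the centers, the class means have the law of `U_s + σ_s n_s^{-1/2} G_s`
with independent standard Gaussian `G_s` (`lintegral_model_classMean`).  By Chebyshev's inequality,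
inner products among `U`, `Ȳ` converge in probability: those of the centers to `C`, those of centers
with class means to `C`, and the Gram matrix of the class means to `K = C + diag(σ² / α)`.
Convergence in probability is expressed by the filter `whp` on the disjoint union of the sample
spaces.  So `‖P_S U_t‖²` tends to the quadratic form `C_t K⁻¹ C_t = σ_t² q_t`, where `C_t` is row
`t` of `C`.  The coefficients of the combined mean are `σ_t⁻¹ K⁻¹ C_t`
(`limitGram_mulVec_meanCoeff`): asymptotically the algorithm uses the direction of the projection
of `U_t` onto `S`, and therefore attains the error of the oracle.
-/

namespace MultitaskGM

open scoped ENNReal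

/-! ### Translations of the standard Gaussian measure -/

theorem lintegral_pi_prod {ι : Type*} [Fintype ι] {X : ι → Type*}
    [∀ i, MeasurableSpace (X i)] (μ : ∀ i, Measure (X i)) [∀ i, IsProbabilityMeasure (μ i)]
    {f : ∀ i, X i → ℝ≥0∞} (hf : ∀ i, Measurable (f i)) :
    ∫⁻ x, ∏ i, f i (x i) ∂Measure.pi μ = ∏ i, ∫⁻ x, f i x ∂μ i := by
  have h := iIndepFun_pi (μ := μ) (X := f) fun i => (hf i).aemeasurable
  have h' := lintegral_prod_eq_prod_lintegral_of_indepFun Finset.univ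
    (fun i (x : ∀ i, X i) => f i (x i)) h
    (fun i => (hf i).comp (measurable_pi_apply i))
  rw [h']
  refine Finset.prod_congr rfl fun i _ => ?_
  exact (measurePreserving_eval μ i).lintegral_comp (hf i)

/-- If each factor map `τ i` turns `μ i` into a measure with density `d i`, the product map turns
the product measure into the measure with the product density. -/
theorem pi_map_eq_withDensity {ι : Type*} [Fintype ι] {X : ι → Type*}
    [∀ i, MeasurableSpace (X i)] (μ : ∀ i, Measure (X i)) [∀ i, IsProbabilityMeasure (μ i)]
    {τ : ∀ i, X i → X i} (hτ : ∀ i, Measurable (τ i)) {d : ∀ i, X i → ℝ≥0∞}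
    (hd : ∀ i, Measurable (d i)) (h : ∀ i, (μ i).map (τ i) = (μ i).withDensity (d i)) :
    (Measure.pi μ).map (fun x i => τ i (x i)) =
      (Measure.pi μ).withDensity fun x => ∏ i, d i (x i) := by
  have hP : ∀ i, IsProbabilityMeasure ((μ i).map (τ i)) := fun i =>
    Measure.isProbabilityMeasure_map (hτ i).aemeasurable
  rw [Measure.pi_map_pi fun i => (hτ i).aemeasurable]
  refine Measure.pi_eq fun s hs => ?_
  rw [withDensity_apply _ (MeasurableSet.univ_pi hs),
    ← lintegral_indicator (MeasurableSet.univ_pi hs)]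
  have h1 : ∀ i, (μ i).map (τ i) (s i) = ∫⁻ x, (s i).indicator (d i) x ∂μ i := fun i => by
    rw [h i, withDensity_apply _ (hs i), lintegral_indicator (hs i)]
  simp_rw [h1]
  rw [← lintegral_pi_prod μ fun i => (hd i).indicator (hs i)]
  refine lintegral_congr fun x => ?_
  by_cases hx : x ∈ Set.univ.pi s
  · rw [Set.indicator_of_mem hx]
    refine Finset.prod_congr rfl fun i _ => ?_
    rw [Set.indicator_of_mem (hx i trivial)]
  · rw [Set.indicator_of_notMem hx]
    simp only [Set.mem_pi, Set.mem_univ, forall_const, not_forall] at hx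
    obtain ⟨i, hi⟩ := hx
    exact (Finset.prod_eq_zero (Finset.mem_univ i) (Set.indicator_of_notMem hi _)).symm

theorem gaussianReal_map_add_eq_withDensity (m : ℝ) :
    (gaussianReal 0 1).map (m + ·) =
      (gaussianReal 0 1).withDensity fun x => ENNReal.ofReal (Real.exp (m * x - m ^ 2 / 2)) := by
  rw [gaussianReal_map_const_add, zero_add, gaussianReal_of_var_ne_zero _ one_ne_zero,
    gaussianReal_of_var_ne_zero _ one_ne_zero,
    ← withDensity_mul _ (measurable_gaussianPDF _ _) (by fun_prop)]
  congr 1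
  funext x
  simp only [gaussianPDF_def, Pi.mul_apply, gaussianPDFReal_def]
  rw [← ENNReal.ofReal_mul (by positivity), mul_assoc (√_)⁻¹, ← Real.exp_add]
  congr 3
  simp
  ring

/-- The density of the standard Gaussian measure translated by `m` with respect to the standard
Gaussian measure. -/
noncomputable def shiftDensity {D : ℕ} (m z : Pt D) : ℝ≥0∞ :=
  ENNReal.ofReal (Real.exp (inner ℝ m z - ‖m‖ ^ 2 / 2))

@[fun_prop]
theorem measurable_shiftDensity {D : ℕ} {X : Type*} [MeasurableSpace X] {f g : X → Pt D}
    (hf : Measurable f) (hg : Measurable g) : Measurable fun x => shiftDensity (f x) (g x) := by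
  unfold shiftDensity
  exact ((hf.inner hg).sub ((hf.norm.pow_const 2).div_const 2)).exp.ennreal_ofReal

/-- The Cameron-Martin formula for the standard Gaussian measure on `ℝ^D`, from the scalar case
coordinate by coordinate. -/
theorem stdGaussian_map_add {D : ℕ} (m : Pt D) :
    (stdGaussian (Pt D)).map (m + ·) = (stdGaussian (Pt D)).withDensity (shiftDensity m) := by
  have h := pi_map_eq_withDensity (fun _ : Fin D => gaussianReal 0 1)
    (τ := fun i x => m i + x) (fun i => measurable_const_add _)
    (d := fun i x => ENNReal.ofReal (Real.exp (m i * x - m i ^ 2 / 2))) (fun i => by fun_prop)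
    (fun i => gaussianReal_map_add_eq_withDensity (m i))
  have hL : Measurable (WithLp.toLp 2 : (Fin D → ℝ) → Pt D) := by fun_prop
  ext s hs
  rw [← map_pi_eq_stdGaussian, Measure.map_map (measurable_const_add m) hL,
    withDensity_apply _ hs, Measure.map_apply (by fun_prop) hs,
    setLIntegral_map hs (by fun_prop) hL]
  have h2 : ((fun x => m + x) ∘ WithLp.toLp 2 : (Fin D → ℝ) → Pt D) =
      WithLp.toLp 2 ∘ fun x i => m i + x i := by
    funext x; rfl
  rw [h2, Set.preimage_comp, ← Measure.map_apply (by fun_prop) (hL hs), h,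
    withDensity_apply _ (hL hs)]
  refine lintegral_congr fun x => ?_
  unfold shiftDensity
  rw [← ENNReal.ofReal_prod_of_nonneg fun _ _ => (Real.exp_pos _).le, ← Real.exp_sum,
    EuclideanSpace.real_norm_sq_eq, Finset.sum_sub_distrib, Finset.sum_div]
  simp [PiLp.inner_apply, mul_comm]

/-- The Cameron-Martin formula for the whole array of noise vectors. -/
theorem lintegral_noise_add {T D : ℕ} {n : Fin T → ℕ} (m : ∀ s, Fin (n s) → Pt D)
    {F : (∀ s, Fin (n s) → Pt D) → ℝ≥0∞} (hF : Measurable F) :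
    ∫⁻ z, F (fun s i => m s i + z s i)
        ∂(Measure.pi fun s => Measure.pi fun _ : Fin (n s) => stdGaussian (Pt D)) =
      ∫⁻ z, (∏ s, ∏ i, shiftDensity (m s i) (z s i)) * F z
        ∂(Measure.pi fun s => Measure.pi fun _ : Fin (n s) => stdGaussian (Pt D)) := by
  have h1 := fun s => pi_map_eq_withDensity (fun _ : Fin (n s) => stdGaussian (Pt D))
    (τ := fun i x => m s i + x) (fun i => measurable_const_add _)
    (d := fun i x => shiftDensity (m s i) x) (fun i => by fun_prop)
    (fun i => stdGaussian_map_add (m s i))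
  have h2 := pi_map_eq_withDensity
    (fun s => Measure.pi fun _ : Fin (n s) => stdGaussian (Pt D))
    (τ := fun s x i => m s i + x i) (fun s => by fun_prop)
    (d := fun s x => ∏ i, shiftDensity (m s i) (x i)) (fun s => by fun_prop) h1
  have h3 : Measurable fun (z : ∀ s, Fin (n s) → Pt D) s i => m s i + z s i := by fun_prop
  refine (lintegral_map (f := F) hF h3).symm.trans ?_
  rw [h2, lintegral_withDensity_eq_lintegral_mul _ (by fun_prop) hF]
  rfl

theorem stdGaussian_map_inner {D : ℕ} (m : Pt D) :
    (stdGaussian (Pt D)).map (fun z => inner ℝ m z) = gaussianReal 0 (‖m‖₊ ^ 2) := by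
  have h := IsGaussian.map_eq_gaussianReal (μ := stdGaussian (Pt D)) (innerSL ℝ m)
  rw [integral_strongDual_stdGaussian, variance_dual_stdGaussian, innerSL_apply_norm] at h
  have e : (‖m‖ ^ 2).toNNReal = ‖m‖₊ ^ 2 := by
    rw [Real.toNNReal_pow (norm_nonneg _), norm_toNNReal]
  rw [e] at h
  exact h

/-! ### The Gaussian tail and the two-point testing problem -/

/-- The upper tail `x ↦ 1 - Φ(x)` of the standard normal law. -/
noncomputable def gaussianTail (x : ℝ) : ℝ≥0∞ := gaussianReal 0 1 (Set.Ioi x)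

theorem gaussianTail_eq (x : ℝ) :
    gaussianTail x = ENNReal.ofReal (1 - cdf (gaussianReal 0 1) x) := by
  rw [cdf_eq_real, ← probReal_compl_eq_one_sub measurableSet_Iic, Set.compl_Iic, ofReal_measureReal]
  rfl

theorem gaussianTail_le_one (x : ℝ) : gaussianTail x ≤ 1 := prob_le_one

theorem continuous_gaussianTail : Continuous gaussianTail := by
  have hc : Continuous (cdf (gaussianReal 0 1)) := by
    have := nullSingletonClass_gaussianReal (μ := 0) one_ne_zero
    refine continuous_iff_continuousAt.2 fun x => ?_
    refine continuousAt_iff_continuous_left'_right'.2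
      ⟨?_, ((cdf _).right_continuous x).mono Set.Ioi_subset_Ici_self⟩
    refine ((monotone_cdf _).continuousWithinAt_Iio_iff_leftLim_eq).2 ?_
    refine le_antisymm ((monotone_cdf _).leftLim_le le_rfl) ?_
    -- a jump of the distribution function would be an atom
    have h := (cdf (gaussianReal 0 1)).measure_singleton x
    rw [measure_cdf, measure_singleton, eq_comm, ENNReal.ofReal_eq_zero] at h
    linarith
  have : gaussianTail = fun x => ENNReal.ofReal (1 - cdf (gaussianReal 0 1) x) :=
    funext gaussianTail_eq
  rw [this]
  exact ENNReal.continuous_ofReal.comp (continuous_const.sub hc)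

theorem stdGaussian_inner_preimage {D : ℕ} {m : Pt D} (hm : m ≠ 0) {S : Set ℝ}
    (hS : MeasurableSet S) :
    stdGaussian (Pt D) {z | inner ℝ m z / ‖m‖ ∈ S} = gaussianReal 0 1 S := by
  have hm' : 0 < ‖m‖ := norm_pos_iff.2 hm
  have h := stdGaussian_map_inner (‖m‖⁻¹ • m)
  have h1 : ‖(‖m‖⁻¹ • m)‖₊ = 1 := by
    ext; simp [norm_smul, hm'.ne']
  rw [h1, one_pow] at h
  rw [← h, Measure.map_apply (by fun_prop) hS]
  congr 1
  ext z
  simp only [Set.mem_ofPred_eq, Set.mem_preimage, real_inner_smul_left, div_eq_inv_mul]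

theorem stdGaussian_inner_gt {D : ℕ} {m : Pt D} (hm : m ≠ 0) (t : ℝ) :
    stdGaussian (Pt D) {z | t * ‖m‖ < inner ℝ m z} = gaussianTail t := by
  rw [gaussianTail, ← stdGaussian_inner_preimage hm measurableSet_Ioi]
  simp only [Set.mem_Ioi, lt_div_iff₀ (norm_pos_iff.2 hm)]

theorem stdGaussian_inner_ge {D : ℕ} {m : Pt D} (hm : m ≠ 0) (t : ℝ) :
    stdGaussian (Pt D) {z | t * ‖m‖ ≤ inner ℝ m z} = gaussianTail t := by
  have := nullSingletonClass_gaussianReal (μ := 0) one_ne_zero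
  rw [gaussianTail, measure_congr Ioi_ae_eq_Ici, ← stdGaussian_inner_preimage hm measurableSet_Ici]
  simp only [Set.mem_Ici, le_div_iff₀ (norm_pos_iff.2 hm)]

theorem stdGaussian_inner_le {D : ℕ} {m : Pt D} (hm : m ≠ 0) (t : ℝ) :
    stdGaussian (Pt D) {z | inner ℝ m z ≤ -(t * ‖m‖)} = gaussianTail t := by
  have h := stdGaussian_inner_ge (neg_ne_zero.2 hm) t
  rw [← h]
  simp only [norm_neg, inner_neg_left, le_neg]

/-- **Neyman-Pearson for two translated Gaussians.**  No test separates the shifts of the standard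
Gaussian measure by `m` and by `-m` better than the half-space `{z | 0 < ⟪m, z⟫}`. -/
theorem two_mul_gaussianTail_le {D : ℕ} (m : Pt D) {E : Set (Pt D)} (hE : MeasurableSet E) :
    2 * gaussianTail ‖m‖ ≤
      stdGaussian (Pt D) {z | m + z ∉ E} + stdGaussian (Pt D) {z | -m + z ∈ E} := by
  rcases eq_or_ne m 0 with rfl | hm
  · have h0 : 2 * gaussianTail 0 ≤ 1 := by
      have h1 : gaussianReal 0 1 (Set.Iio 0) = gaussianTail 0 := by
        have h2 := gaussianReal_map_neg (μ := 0) (v := 1)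
        rw [neg_zero] at h2
        rw [gaussianTail, ← h2, Measure.map_apply measurable_neg measurableSet_Iio, h2]
        simp
      have h3 : gaussianReal 0 1 (Set.Iio 0 ∪ Set.Ioi 0) ≤ 1 := prob_le_one
      rw [measure_union (Set.disjoint_left.2 fun x hx hx' =>
        lt_asymm (Set.mem_Iio.1 hx) (Set.mem_Ioi.1 hx')) measurableSet_Ioi, h1]
        at h3
      rwa [two_mul]
    have h4 := prob_add_prob_compl (μ := stdGaussian (Pt D)) hE
    simp only [norm_zero, zero_add, neg_zero]
    rw [add_comm]
    exact h0.trans h4.ge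
  have hH : MeasurableSet {z : Pt D | 0 < inner ℝ m z} :=
    measurableSet_lt measurable_const (by fun_prop)
  -- the total error of a test, as an integral against the common reference measure
  have key : ∀ S : Set (Pt D), MeasurableSet S →
      stdGaussian (Pt D) {z | m + z ∉ S} + stdGaussian (Pt D) {z | -m + z ∈ S} =
        ∫⁻ z, (Sᶜ.indicator (shiftDensity m) z + S.indicator (shiftDensity (-m)) z)
          ∂stdGaussian (Pt D) := by
    intro S hS
    have hm1 : Measurable (shiftDensity m) := by fun_prop
    have hm2 : Measurable (shiftDensity (-m)) := by fun_prop
    rw [lintegral_add_left (hm1.indicator hS.compl), lintegral_indicator hS.compl,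
      lintegral_indicator hS, ← withDensity_apply _ hS.compl, ← withDensity_apply _ hS,
      ← stdGaussian_map_add, ← stdGaussian_map_add,
      Measure.map_apply (measurable_const_add _) hS.compl,
      Measure.map_apply (measurable_const_add _) hS]
    rfl
  refine le_trans ?_ (le_trans (key _ hH).le (le_trans (lintegral_mono fun z => ?_) (key E hE).ge))
  · rw [two_mul]
    refine add_le_add ?_ ?_
    · rw [← stdGaussian_inner_le hm]
      refine measure_mono fun z hz => ?_
      simp only [Set.mem_ofPred_eq, inner_add_right, real_inner_self_eq_norm_sq] at hz ⊢
      nlinarith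
    · rw [← stdGaussian_inner_gt hm]
      refine measure_mono fun z hz => ?_
      simp only [Set.mem_ofPred_eq, inner_add_right, inner_neg_right,
        real_inner_self_eq_norm_sq] at hz ⊢
      nlinarith
  · have h1 : 0 < inner ℝ m z → shiftDensity (-m) z ≤ shiftDensity m z := fun h =>
      ENNReal.ofReal_le_ofReal <| Real.exp_le_exp.2 <| by
        simp only [inner_neg_left, norm_neg]; linarith
    have h2 : ¬ 0 < inner ℝ m z → shiftDensity m z ≤ shiftDensity (-m) z := fun h =>
      ENNReal.ofReal_le_ofReal <| Real.exp_le_exp.2 <| by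
        simp only [inner_neg_left, norm_neg]; linarith
    by_cases h : 0 < inner ℝ m z <;> by_cases h' : z ∈ E <;> simp [Set.indicator, h, h', h1, h2]

/-- Two Gaussian populations with common covariance `σ² I` and means `u`, `v`: two disjoint
acceptance regions have total error at least `2 (1 - Φ(‖u - v‖ / (2 σ)))`. -/
theorem two_mul_gaussianTail_le_of_disjoint {D : ℕ} {σ : ℝ} (hσ : 0 < σ) (u v : Pt D)
    {A B : Set (Pt D)} (hA : MeasurableSet A) (hAB : Disjoint A B) :
    2 * gaussianTail (‖u - v‖ / (2 * σ)) ≤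
      stdGaussian (Pt D) {z | u + σ • z ∉ A} + stdGaussian (Pt D) {z | v + σ • z ∉ B} := by
  -- centre at the midpoint of the means and rescale to unit covariance
  set m : Pt D := (2 * σ)⁻¹ • (u - v) with hm
  set c : Pt D := (2 : ℝ)⁻¹ • (u + v) with hc
  have hE : MeasurableSet ((fun z => c + σ • z) ⁻¹' A) :=
    (show Measurable fun z : Pt D => c + σ • z by fun_prop) hA
  have hσ2 : σ * (2 * σ)⁻¹ = 2⁻¹ := by field_simp
  have hu : ∀ z, c + σ • (m + z) = u + σ • z := fun z => by
    rw [smul_add, hm, smul_smul, hσ2, hc]; module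
  have hv : ∀ z, c + σ • (-m + z) = v + σ • z := fun z => by
    rw [smul_add, hm, smul_neg, smul_smul, hσ2, hc]; module
  have h := two_mul_gaussianTail_le m hE
  have hn : ‖m‖ = ‖u - v‖ / (2 * σ) := by
    rw [hm, norm_smul, norm_inv, Real.norm_of_nonneg (by positivity), div_eq_inv_mul]
  rw [hn] at h
  refine h.trans (add_le_add (measure_mono fun z hz => ?_) (measure_mono fun z hz => ?_))
  · show u + σ • z ∉ A
    rw [← hu]; exact hz
  · have : v + σ • z ∈ A := by rw [← hv]; exact hz
    exact Set.disjoint_left.1 hAB this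

/-! ### Rotation invariance of the law of the centers -/

/-- The Gram-Schmidt process commutes with linear isometries. -/
theorem gramSchmidt_comp_linearIsometryEquiv {T D : ℕ} (L : Pt D ≃ₗᵢ[ℝ] Pt D)
    (g : Fin T → Pt D) (r : Fin T) :
    InnerProductSpace.gramSchmidt ℝ (fun s => L (g s)) r =
      L (InnerProductSpace.gramSchmidt ℝ g r) := by
  induction r using WellFoundedLT.induction with
  | ind r ih =>
    have h1 := eq_sub_of_add_eq (InnerProductSpace.gramSchmidt_def'' ℝ g r).symm
    have h2 := eq_sub_of_add_eq (InnerProductSpace.gramSchmidt_def'' ℝ (fun s => L (g s)) r).symm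
    rw [h1, h2, map_sub, map_sum]
    congr 1
    refine Finset.sum_congr rfl fun i hi => ?_
    rw [ih i (Finset.mem_Iio.1 hi), map_smul, L.inner_map_map, L.norm_map]

theorem centers_comp_linearIsometryEquiv {T D : ℕ} (C : Matrix (Fin T) (Fin T) ℝ)
    (L : Pt D ≃ₗᵢ[ℝ] Pt D) (g : Fin T → Pt D) :
    centers C (fun s => L (g s)) = fun s => L (centers C g s) := by
  funext s
  simp only [centers, InnerProductSpace.gramSchmidtNormed, gramSchmidt_comp_linearIsometryEquiv,
    L.norm_map, map_sum, map_smul]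

theorem lintegral_centerLaw {T D : ℕ} (C : Matrix (Fin T) (Fin T) ℝ)
    {F : (Fin T → Pt D) → ℝ≥0∞} (hF : Measurable F) :
    ∫⁻ u, F u ∂centerLaw C D =
      ∫⁻ g, F (centers C g) ∂Measure.pi fun _ : Fin T => stdGaussian (Pt D) :=
  lintegral_map hF (measurable_centers C)

/-- The law of the centers is rotation invariant. -/
theorem lintegral_centerLaw_comp {T D : ℕ} (C : Matrix (Fin T) (Fin T) ℝ)
    (L : Pt D ≃ₗᵢ[ℝ] Pt D) {F : (Fin T → Pt D) → ℝ≥0∞} (hF : Measurable F) :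
    ∫⁻ u, F (fun s => L (u s)) ∂centerLaw C D = ∫⁻ u, F u ∂centerLaw C D := by
  have hL : Measurable L := L.continuous.measurable
  have hm : Measurable fun (g : Fin T → Pt D) s => L (g s) := by fun_prop
  have hP : ∀ _ : Fin T, IsProbabilityMeasure ((stdGaussian (Pt D)).map L) := fun _ =>
    Measure.isProbabilityMeasure_map hL.aemeasurable
  have h := Measure.pi_map_pi (μ := fun _ : Fin T => stdGaussian (Pt D)) (f := fun _ => L)
    fun _ => hL.aemeasurable
  rw [stdGaussian_map L] at h
  rw [lintegral_centerLaw C (F := fun u => F fun s => L (u s)) (hF.comp hm),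
    lintegral_centerLaw C hF]
  simp only [← centers_comp_linearIsometryEquiv]
  have h1 := lintegral_map (μ := Measure.pi fun _ : Fin T => stdGaussian (Pt D))
    (f := fun g => F (centers C g)) (hF.comp (measurable_centers C)) hm
  rw [h] at h1
  exact h1.symm

/-! ### The projection of a center onto the span of the class means -/

/-- The squared length of the orthogonal projection of `u` onto the span of the vectors `y s`,
written with the Gram matrix of `y`; meaningful when that matrix is invertible
(see `norm_starProjection_span`). -/
noncomputable def projNormSq {T D : ℕ} (u : Pt D) (y : Fin T → Pt D) : ℝ :=
  (fun s => inner ℝ u (y s)) ⬝ᵥ (Matrix.gram ℝ y)⁻¹ *ᵥ fun s => inner ℝ u (y s)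

/-- The coefficients of the projection solve the normal equations, whose matrix is the Gram matrix
of `y`. -/
theorem norm_starProjection_span {T D : ℕ} (u : Pt D) (y : Fin T → Pt D)
    (hy : (Matrix.gram ℝ y).det ≠ 0) :
    ‖(Submodule.span ℝ (Set.range y)).starProjection u‖ = √(projNormSq u y) := by
  set b : Fin T → ℝ := fun s => inner ℝ u (y s) with hb
  set c : Fin T → ℝ := (Matrix.gram ℝ y)⁻¹ *ᵥ b with hc
  have hGc : Matrix.gram ℝ y *ᵥ c = b := by
    rw [hc, Matrix.mulVec_mulVec, Matrix.mul_nonsing_inv _ (isUnit_iff_ne_zero.2 hy),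
      Matrix.one_mulVec]
  set w : Pt D := ∑ s, c s • y s with hw
  have hwy : ∀ s, inner ℝ w (y s) = inner ℝ u (y s) := fun s => by
    have h := congrFun hGc s
    simp only [Matrix.mulVec, dotProduct, Matrix.gram_apply, hb] at h
    rw [hw, sum_inner, ← h]
    refine Finset.sum_congr rfl fun i _ => ?_
    rw [real_inner_smul_left, real_inner_comm, mul_comm]
  have hmem : w ∈ Submodule.span ℝ (Set.range y) :=
    Submodule.sum_mem _ fun s _ => Submodule.smul_mem _ _ (Submodule.subset_span ⟨s, rfl⟩)
  have hproj : (Submodule.span ℝ (Set.range y)).starProjection u = w := by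
    refine Submodule.eq_starProjection_of_mem_of_inner_eq_zero hmem fun v hv => ?_
    induction hv using Submodule.span_induction with
    | mem x hx =>
      obtain ⟨s, rfl⟩ := hx
      rw [inner_sub_left, hwy, sub_self]
    | zero => exact inner_zero_right _
    | add x z _ _ hx hz => rw [inner_add_right, hx, hz, add_zero]
    | smul a x _ hx => rw [inner_smul_right, hx, mul_zero]
  have hn : ‖w‖ ^ 2 = projNormSq u y := by
    rw [← real_inner_self_eq_norm_sq]
    conv_lhs => rw [hw, inner_sum]
    simp only [inner_smul_right, ← hw, hwy]
    exact Finset.sum_congr rfl fun s _ => mul_comm _ _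
  rw [hproj, ← hn, Real.sqrt_sq (norm_nonneg _)]

/-- The error probability `1 - Φ(‖P u‖ / σ)` of an oracle that is told the projection `P u` of the
center onto the span of the class means `y`.  It is replaced by the trivial bound `0` when the Gram
matrix of `y` is singular. -/
noncomputable def oracleError {T D : ℕ} (σ : ℝ) (u : Pt D) (y : Fin T → Pt D) : ℝ≥0∞ :=
  if (Matrix.gram ℝ y).det = 0 then 0 else gaussianTail (√(projNormSq u y) / σ)

theorem continuous_det_gram {T D : ℕ} :
    Continuous fun y : Fin T → Pt D => (Matrix.gram ℝ y).det :=
  Continuous.matrix_det (continuous_matrix fun i j => by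
    simp only [Matrix.gram_apply]; fun_prop)

@[fun_prop]
theorem measurable_projNormSq {T D : ℕ} {X : Type*} [MeasurableSpace X] {u : X → Pt D}
    {y : X → Fin T → Pt D} (hu : Measurable u) (hy : Measurable y) :
    Measurable fun x => projNormSq (u x) (y x) := by
  have hb : ∀ s, Measurable fun x => inner ℝ (u x) (y x s) := fun s => by fun_prop
  have hadj : ∀ i j, Measurable fun x => (Matrix.gram ℝ (y x)).adjugate i j := fun i j => by
    have hc : Continuous fun w : Fin T → Pt D => (Matrix.gram ℝ w).adjugate i j := by
      refine Continuous.matrix_elem (Continuous.matrix_adjugate ?_) i j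
      exact continuous_matrix fun i j => by simp only [Matrix.gram_apply]; fun_prop
    exact hc.measurable.comp hy
  have hdet : Measurable fun x => (Matrix.gram ℝ (y x)).det :=
    continuous_det_gram.measurable.comp hy
  have e : (fun x => projNormSq (u x) (y x)) = fun x =>
      ∑ i, inner ℝ (u x) (y x i) * ∑ j, (Matrix.gram ℝ (y x)).det⁻¹ *
        (Matrix.gram ℝ (y x)).adjugate i j * inner ℝ (u x) (y x j) := by
    funext x
    simp [projNormSq, dotProduct, Matrix.mulVec, Matrix.inv_def]
  rw [e]
  exact Finset.measurable_fun_sum _ fun i _ => (hb i).mul <|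
    Finset.measurable_fun_sum _ fun j _ => (hdet.inv.mul (hadj i j)).mul (hb j)

@[fun_prop]
theorem measurable_oracleError {T D : ℕ} (σ : ℝ) {X : Type*} [MeasurableSpace X] {u : X → Pt D}
    {y : X → Fin T → Pt D} (hu : Measurable u) (hy : Measurable y) :
    Measurable fun x => oracleError σ (u x) (y x) := by
  have hp := measurable_projNormSq hu hy
  have hdet : Measurable fun x => (Matrix.gram ℝ (y x)).det :=
    continuous_det_gram.measurable.comp hy
  unfold oracleError
  exact Measurable.ite (hdet (measurableSet_singleton 0)) measurable_const
    (continuous_gaussianTail.measurable.comp (hp.sqrt.div_const σ))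

/-! ### Classifying one new point -/

/-- Twice the misclassification probability of the rule `h` for a new point `±u + σ z`. -/
noncomputable def newError {D : ℕ} (σ : ℝ) (h : Pt D → ℝ) (u : Pt D) : ℝ≥0∞ :=
  stdGaussian (Pt D) {z | h (u + σ • z) ≠ 1} + stdGaussian (Pt D) {z | h (-u + σ • z) ≠ -1}

/-- The new point `u + σ z` of class `1` has to be told from the point `-R u + σ z` of class `-1`,
where `R` is the reflection in `K`; the two means differ by twice the projection of `u`
onto `K`. -/
theorem newError_add_newError_reflection {D : ℕ} {σ : ℝ} (hσ : 0 < σ) {h : Pt D → ℝ}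
    (hh : Measurable h) (K : Submodule ℝ (Pt D)) (u : Pt D) :
    2 * gaussianTail (‖K.starProjection u‖ / σ) + 2 * gaussianTail (‖K.starProjection u‖ / σ) ≤
      newError σ h u + newError σ h (K.reflection u) := by
  have hA : MeasurableSet (h ⁻¹' {1}) := hh (measurableSet_singleton _)
  have hAB : Disjoint (h ⁻¹' {1}) (h ⁻¹' {-1}) :=
    Disjoint.preimage h (by rw [Set.disjoint_singleton]; norm_num)
  have h1 := two_mul_gaussianTail_le_of_disjoint hσ u (-K.reflection u) hA hAB
  have h2 := two_mul_gaussianTail_le_of_disjoint hσ (K.reflection u) (-u) hA hAB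
  have e : ‖K.starProjection u‖ / σ = ‖u - -K.reflection u‖ / (2 * σ) := by
    have : u - -K.reflection u = (2 : ℝ) • K.starProjection u := by
      rw [Submodule.reflection_apply]; module
    rw [this, norm_smul, Real.norm_ofNat, mul_div_mul_left _ _ two_ne_zero]
  have e' : ‖K.starProjection u‖ / σ = ‖K.reflection u - -u‖ / (2 * σ) := by
    rw [e]; congr 2; abel
  rw [← e] at h1
  rw [← e'] at h2
  refine (add_le_add h1 h2).trans (le_of_eq ?_)
  unfold newError
  simp only [Set.mem_preimage, Set.mem_singleton_iff]
  abel

/-! ### The likelihood of the training data -/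

theorem prod_shiftDensity {D k : ℕ} (c : ℝ) (v : Fin k → ℝ) (u : Pt D) (z : Fin k → Pt D) :
    ∏ i, shiftDensity ((c * v i) • u) (z i) =
      ENNReal.ofReal (Real.exp (c * inner ℝ u (∑ i, v i • z i) -
        ‖u‖ ^ 2 * ∑ i, (c * v i) ^ 2 / 2)) := by
  unfold shiftDensity
  rw [← ENNReal.ofReal_prod_of_nonneg fun _ _ => (Real.exp_pos _).le, ← Real.exp_sum,
    Finset.sum_sub_distrib, inner_sum, Finset.mul_sum, Finset.mul_sum]
  congr 3
  · refine Finset.sum_congr rfl fun i _ => ?_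
    rw [real_inner_smul_left, inner_smul_right]; ring
  · refine Finset.sum_congr rfl fun i _ => ?_
    rw [norm_smul, mul_pow, Real.norm_eq_abs, sq_abs]; ring

/-- The density of the training noise after absorbing the signal `v s i • u s`, with respect to
the law of the noise. -/
noncomputable def likelihood {T D : ℕ} {n : Fin T → ℕ} (σ : Fin T → ℝ) (v : ∀ s, Fin (n s) → ℝ)
    (u : Fin T → Pt D) (z : ∀ s, Fin (n s) → Pt D) : ℝ≥0∞ :=
  ∏ s, ∏ i, shiftDensity (((σ s)⁻¹ * v s i) • u s) (z s i)

theorem measurable_likelihood {T D : ℕ} {n : Fin T → ℕ} (σ : Fin T → ℝ)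
    (v : ∀ s, Fin (n s) → ℝ) :
    Measurable fun p : (Fin T → Pt D) × (∀ s, Fin (n s) → Pt D) => likelihood σ v p.1 p.2 := by
  unfold likelihood
  fun_prop

/-- The likelihood sees the centers only through their lengths and their inner products with the
class means, which a reflection fixing the class means preserves. -/
theorem likelihood_reflection {T D : ℕ} {n : Fin T → ℕ} {σ : Fin T → ℝ} (hσ : ∀ s, 0 < σ s)
    (v : ∀ s, Fin (n s) → ℝ) (u : Fin T → Pt D) (z : ∀ s, Fin (n s) → Pt D)
    (K : Submodule ℝ (Pt D)) (hK : ∀ s, classMean v (fun s i => σ s • z s i) s ∈ K) :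
    likelihood σ v (fun s => K.reflection (u s)) z = likelihood σ v u z := by
  unfold likelihood
  refine Finset.prod_congr rfl fun s _ => ?_
  rw [prod_shiftDensity, prod_shiftDensity, LinearIsometryEquiv.norm_map]
  have hmem : ∑ i, v s i • z s i ∈ K := by
    rcases eq_or_ne (n s : ℝ) 0 with h0 | h0
    · have : IsEmpty (Fin (n s)) := by
        rw [Nat.cast_eq_zero.1 h0]; infer_instance
      rw [Finset.univ_eq_empty, Finset.sum_empty]; exact K.zero_mem
    · have h1 := K.smul_mem ((σ s)⁻¹ * n s) (hK s)
      rw [classMean, smul_smul, mul_assoc, mul_inv_cancel₀ h0, mul_one, Finset.smul_sum] at h1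
      convert h1 using 2 with i
      rw [smul_comm (v s i), smul_smul, inv_mul_cancel₀ (hσ s).ne', one_smul]
  congr 4
  conv_lhs => rw [← K.reflection_mem_subspace_eq_self hmem, LinearIsometryEquiv.inner_map_map]

/-- The law of the training noise. -/
noncomputable abbrev noiseLaw {T : ℕ} (n : Fin T → ℕ) (D : ℕ) :
    Measure (∀ s, Fin (n s) → Pt D) :=
  Measure.pi fun s => Measure.pi fun _ : Fin (n s) => stdGaussian (Pt D)

theorem lintegral_data {T D : ℕ} {n : Fin T → ℕ} {σ : Fin T → ℝ} (hσ : ∀ s, 0 < σ s)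
    (v : ∀ s, Fin (n s) → ℝ) (u : Fin T → Pt D) {F : (∀ s, Fin (n s) → Pt D) → ℝ≥0∞}
    (hF : Measurable F) :
    ∫⁻ z, F (fun s i => v s i • u s + σ s • z s i) ∂noiseLaw n D =
      ∫⁻ z, likelihood σ v u z * F (fun s i => σ s • z s i) ∂noiseLaw n D := by
  have hm : Measurable fun (z : ∀ s, Fin (n s) → Pt D) s i => σ s • z s i := by fun_prop
  have h := lintegral_noise_add (fun s i => ((σ s)⁻¹ * v s i) • u s)
    (F := fun z => F fun s i => σ s • z s i) (hF.comp hm)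
  refine Eq.trans ?_ h
  refine lintegral_congr fun z => ?_
  congr 1
  funext s i
  rw [smul_add, smul_smul, mul_inv_cancel_left₀ (hσ s).ne']

@[fun_prop]
theorem measurable_classMean {T D : ℕ} {n : Fin T → ℕ} (v : ∀ s, Fin (n s) → ℝ) :
    Measurable (classMean v : (∀ s, Fin (n s) → Pt D) → Fin T → Pt D) := by
  unfold classMean
  fun_prop

theorem measurable_newError {D : ℕ} (σ : ℝ) {X : Type*} [MeasurableSpace X]
    {h : X → Pt D → ℝ} (hh : Measurable fun p : X × Pt D => h p.1 p.2) {u : X → Pt D}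
    (hu : Measurable u) : Measurable fun x => newError σ (h x) (u x) := by
  have key : ∀ (u : X → Pt D), Measurable u → ∀ c : ℝ,
      Measurable fun x => stdGaussian (Pt D) {z | h x (u x + σ • z) ≠ c} := fun u hu c => by
    have hS : MeasurableSet {p : X × Pt D | h p.1 (u p.1 + σ • p.2) ≠ c} := by
      have : Measurable fun p : X × Pt D => h p.1 (u p.1 + σ • p.2) :=
        hh.comp (by fun_prop : Measurable fun p : X × Pt D => (p.1, u p.1 + σ • p.2))
      exact (this (measurableSet_singleton c)).compl
    exact measurable_measure_prodMk_left hS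
  exact (key u hu 1).add (key (fun x => -u x) hu.neg (-1))

/-- The joint law of centers and training data, written with the likelihood and with the
integration over the centers innermost, so that the data are fixed there. -/
theorem lintegral_centerLaw_data {T D : ℕ} {n : Fin T → ℕ} (C : Matrix (Fin T) (Fin T) ℝ)
    {σ : Fin T → ℝ} (hσ : ∀ s, 0 < σ s) (v : ∀ s, Fin (n s) → ℝ)
    {F : (Fin T → Pt D) → (∀ s, Fin (n s) → Pt D) → ℝ≥0∞}
    (hF : Measurable fun p : (Fin T → Pt D) × (∀ s, Fin (n s) → Pt D) => F p.1 p.2) :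
    ∫⁻ u, ∫⁻ z, F u (fun s i => v s i • u s + σ s • z s i) ∂noiseLaw n D ∂centerLaw C D =
      ∫⁻ z, ∫⁻ u, likelihood σ v u z * F u (fun s i => σ s • z s i)
        ∂centerLaw C D ∂noiseLaw n D := by
  have hm : Measurable fun p : (Fin T → Pt D) × (∀ s, Fin (n s) → Pt D) =>
      (p.1, fun s i => σ s • p.2 s i) := by fun_prop
  refine Eq.trans (lintegral_congr fun u =>
    lintegral_data hσ v u (hF.comp measurable_prodMk_left)) (lintegral_lintegral_swap ?_)
  exact ((measurable_likelihood σ v).mul (hF.comp hm)).aemeasurable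

/-- The posterior of the centers is invariant under the reflection in the span of the class means,
so that each center may be averaged with its mirror image. -/
theorem lintegral_likelihood_oracleError_le {T D : ℕ} {n : Fin T → ℕ}
    (C : Matrix (Fin T) (Fin T) ℝ) {σ : Fin T → ℝ} (hσ : ∀ s, 0 < σ s) (t : Fin T)
    (v : ∀ s, Fin (n s) → ℝ) {h : Pt D → ℝ} (hh : Measurable h) (z : ∀ s, Fin (n s) → Pt D) :
    2 * ∫⁻ u, likelihood σ v u z *
        oracleError (σ t) (u t) (classMean v fun s i => σ s • z s i) ∂centerLaw C D ≤
      ∫⁻ u, likelihood σ v u z * newError (σ t) h (u t) ∂centerLaw C D := by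
  set m : Fin T → Pt D := classMean v fun s i => σ s • z s i with hm
  set K := Submodule.span ℝ (Set.range m) with hK
  have hmemK : ∀ s, m s ∈ K := fun s => Submodule.subset_span ⟨s, rfl⟩
  have hl : Measurable fun u : Fin T → Pt D => likelihood σ v u z := by
    unfold likelihood
    fun_prop
  have hh' : Measurable fun p : (Fin T → Pt D) × Pt D => h p.2 := hh.comp measurable_snd
  have hn : Measurable fun u : Fin T → Pt D => newError (σ t) h (u t) :=
    measurable_newError (σ t) (X := Fin T → Pt D) (h := fun _ => h) hh' (measurable_pi_apply t)
  have hln : Measurable fun u : Fin T → Pt D =>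
      likelihood σ v u z * newError (σ t) h (u t) := hl.mul hn
  have hinv := lintegral_centerLaw_comp C K.reflection hln
  simp only [likelihood_reflection hσ v _ z K hmemK] at hinv
  -- the pointwise bound for a configuration of centers together with its mirror image
  have hpt : ∀ u : Fin T → Pt D, 4 * oracleError (σ t) (u t) m ≤
      newError (σ t) h (u t) + newError (σ t) h (K.reflection (u t)) := fun u => by
    unfold oracleError
    split_ifs with hdet
    · simp
    · refine le_trans (le_of_eq ?_) (newError_add_newError_reflection (hσ t) hh K (u t))
      rw [hK, norm_starProjection_span _ _ hdet, ← two_mul, ← mul_assoc]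
      norm_num
  have h4 : 2 * (2 * ∫⁻ u, likelihood σ v u z * oracleError (σ t) (u t) m ∂centerLaw C D) ≤
      2 * ∫⁻ u, likelihood σ v u z * newError (σ t) h (u t) ∂centerLaw C D := by
    rw [two_mul (∫⁻ u, likelihood σ v u z * newError (σ t) h (u t) ∂centerLaw C D)]
    nth_rewrite 2 [← hinv]
    rw [← lintegral_add_left hln, ← mul_assoc, ← lintegral_const_mul' _ _ (by finiteness)]
    refine lintegral_mono fun u => ?_
    rw [← mul_add, mul_left_comm]
    refine mul_le_mul_right ?_ _
    refine le_trans (le_of_eq ?_) (hpt u)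
    norm_num
  exact (ENNReal.mul_le_mul_iff_right (by norm_num) (by norm_num)).1 h4

/-- For a fixed array of classes, averaging over the centers and the training data, no rule beats
the oracle. -/
theorem oracleError_le_newError {T D : ℕ} {n : Fin T → ℕ} (C : Matrix (Fin T) (Fin T) ℝ)
    {σ : Fin T → ℝ} (hσ : ∀ s, 0 < σ s) (t : Fin T) (v : ∀ s, Fin (n s) → ℝ)
    {h : (∀ s, Fin (n s) → Pt D) → Pt D → ℝ}
    (hh : Measurable fun p : (∀ s, Fin (n s) → Pt D) × Pt D => h p.1 p.2) :
    2 * ∫⁻ u, ∫⁻ z, oracleError (σ t) (u t)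
        (classMean v fun s i => v s i • u s + σ s • z s i) ∂noiseLaw n D ∂centerLaw C D ≤
      ∫⁻ u, ∫⁻ z, newError (σ t) (h fun s i => v s i • u s + σ s • z s i) (u t)
        ∂noiseLaw n D ∂centerLaw C D := by
  have ho : Measurable fun p : (Fin T → Pt D) × (∀ s, Fin (n s) → Pt D) =>
      oracleError (σ t) (p.1 t) (classMean v p.2) :=
    measurable_oracleError (σ t) (by fun_prop) (by fun_prop)
  have hq : Measurable fun q : ((Fin T → Pt D) × (∀ s, Fin (n s) → Pt D)) × Pt D =>
      (q.1.2, q.2) := by fun_prop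
  have hh' : Measurable fun q : ((Fin T → Pt D) × (∀ s, Fin (n s) → Pt D)) × Pt D =>
      h q.1.2 q.2 := hh.comp hq
  have hu : Measurable fun p : (Fin T → Pt D) × (∀ s, Fin (n s) → Pt D) => p.1 t := by fun_prop
  have hn : Measurable fun p : (Fin T → Pt D) × (∀ s, Fin (n s) → Pt D) =>
      newError (σ t) (h p.2) (p.1 t) :=
    measurable_newError (σ t) (h := fun p : (Fin T → Pt D) × (∀ s, Fin (n s) → Pt D) => h p.2)
      hh' hu
  rw [lintegral_centerLaw_data C hσ v (F := fun u y => oracleError (σ t) (u t) (classMean v y)) ho,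
    lintegral_centerLaw_data C hσ v (F := fun u y => newError (σ t) (h y) (u t)) hn,
    ← lintegral_const_mul' _ _ (by finiteness)]
  refine lintegral_mono fun z => ?_
  have hz : Measurable fun x : Pt D => ((fun s i => σ s • z s i : ∀ s, Fin (n s) → Pt D), x) := by
    fun_prop
  exact lintegral_likelihood_oracleError_le C hσ t v (hh.comp hz) z

/-! ### The risk as an iterated integral -/

theorem classLaw_eq :
    classLaw = (2⁻¹ : ℝ≥0∞) • Measure.dirac (1 : ℝ) + (2⁻¹ : ℝ≥0∞) • Measure.dirac (-1 : ℝ) := by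
  have hd : Disjoint ({-1} : Set ℝ) {1} := by rw [Set.disjoint_singleton]; norm_num
  have h2 : Measure.count ({-1, 1} : Set ℝ) = 2 := by
    rw [Set.insert_eq, measure_union hd (measurableSet_singleton _), Measure.count_singleton,
      Measure.count_singleton, one_add_one_eq_two]
  ext s hs
  rw [classLaw, uniformOn, cond_apply (by measurability), h2, Set.insert_eq,
    Set.union_inter_distrib_right,
    measure_union (hd.mono Set.inter_subset_left Set.inter_subset_left)
      ((measurableSet_singleton _).inter hs), mul_add]
  have h3 : ∀ x : ℝ, Measure.count ({x} ∩ s) = Measure.dirac x s := fun x => by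
    by_cases hx : x ∈ s <;> simp [hx, hs]
  simp [h3, add_comm]

instance : IsProbabilityMeasure classLaw :=
  isProbabilityMeasure_uniformOn (by simp) (by simp)

theorem classLaw_prod_apply {D : ℕ} {S : Set (ℝ × Pt D)} (hS : MeasurableSet S) :
    classLaw.prod (stdGaussian (Pt D)) S =
      2⁻¹ * (stdGaussian (Pt D) {z | (1, z) ∈ S} + stdGaussian (Pt D) {z | (-1, z) ∈ S}) := by
  rw [Measure.prod_apply hS, classLaw_eq, lintegral_add_measure, lintegral_smul_measure,
    lintegral_smul_measure, lintegral_dirac, lintegral_dirac, mul_add]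
  rfl

/-- The event that the classifier `f` misclassifies the new point. -/
def misclassified {T D : ℕ} {n : Fin T → ℕ} (σ : Fin T → ℝ) (t : Fin T) (f : Obs T n D → ℝ) :
    Set ((∀ s, Fin (n s) → ℝ) × (Fin T → Pt D) × (∀ s, Fin (n s) → Pt D) × ℝ × Pt D) :=
  {ω | f (ω.1, (fun s i => ω.1 s i • ω.2.1 s + σ s • ω.2.2.1 s i),
    ω.2.2.2.1 • ω.2.1 t + σ t • ω.2.2.2.2) ≠ ω.2.2.2.1}

theorem modelLaw_misclassified {T D : ℕ} {n : Fin T → ℕ} (C : Matrix (Fin T) (Fin T) ℝ)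
    (σ : Fin T → ℝ) (t : Fin T) {f : Obs T n D → ℝ} (hf : Measurable f) :
    modelLaw C n D (misclassified σ t f) =
      ∫⁻ v, ∫⁻ u, ∫⁻ z, 2⁻¹ * newError (σ t)
        (fun x => f (v, (fun s i => v s i • u s + σ s • z s i), x)) (u t)
        ∂noiseLaw n D ∂centerLaw C D
        ∂(Measure.pi fun s => Measure.pi fun _ : Fin (n s) => classLaw) := by
  have hS : MeasurableSet (misclassified (D := D) σ t f) := by
    exact (measurableSet_eq_fun (hf.comp (by fun_prop)) (by fun_prop)).compl
  rw [modelLaw, Measure.prod_apply hS]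
  refine lintegral_congr fun v => ?_
  have hS1 := measurable_prodMk_left (x := v) hS
  rw [Measure.prod_apply hS1]
  refine lintegral_congr fun u => ?_
  have hS2 := measurable_prodMk_left (x := u) hS1
  rw [Measure.prod_apply hS2]
  refine lintegral_congr fun z => ?_
  have hS3 := measurable_prodMk_left (x := z) hS2
  rw [classLaw_prod_apply hS3]
  simp [newError, misclassified]

/-- In every dimension, no classifier errs less often than the oracle. -/
theorem oracleError_le_modelLaw {T D : ℕ} {n : Fin T → ℕ} (C : Matrix (Fin T) (Fin T) ℝ)
    {σ : Fin T → ℝ} (hσ : ∀ s, 0 < σ s) (t : Fin T) {f : Obs T n D → ℝ} (hf : Measurable f) :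
    ∫⁻ v, ∫⁻ u, ∫⁻ z, oracleError (σ t) (u t)
        (classMean v fun s i => v s i • u s + σ s • z s i) ∂noiseLaw n D ∂centerLaw C D
        ∂(Measure.pi fun s => Measure.pi fun _ : Fin (n s) => classLaw) ≤
      modelLaw C n D (misclassified σ t f) := by
  rw [modelLaw_misclassified C σ t hf]
  refine lintegral_mono fun v => ?_
  have h := oracleError_le_newError C hσ t v (h := fun y x => f (v, y, x)) (by fun_prop)
  simp_rw [lintegral_const_mul' (2⁻¹ : ℝ≥0∞) _ (by norm_num)]
  refine le_trans (le_of_eq ?_) (mul_le_mul_right h 2⁻¹)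
  rw [← mul_assoc, ENNReal.inv_mul_cancel (by norm_num) (by norm_num), one_mul]

/-! ### The error of a linear classifier -/

theorem newError_sign {D : ℕ} {σ : ℝ} (hσ : 0 < σ) (u : Pt D) {w : Pt D} (hw : w ≠ 0) :
    newError σ (fun x => Real.sign (inner ℝ x w)) u =
      2 * gaussianTail (inner ℝ u w / (σ * ‖w‖)) := by
  have hw' : 0 < ‖w‖ := norm_pos_iff.2 hw
  have hone : ∀ r : ℝ, Real.sign r ≠ 1 ↔ r ≤ 0 := fun r => by
    rcases lt_trichotomy r 0 with h | rfl | h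
    · simp only [Real.sign_of_neg h, h.le, iff_true]; norm_num
    · simp
    · simp [Real.sign_of_pos h, h]
  have hneg : ∀ r : ℝ, Real.sign r ≠ -1 ↔ 0 ≤ r := fun r => by
    rcases lt_trichotomy r 0 with h | rfl | h
    · simp [Real.sign_of_neg h, h]
    · simp
    · simp only [Real.sign_of_pos h, h.le, iff_true]; norm_num
  have ht : inner ℝ u w / (σ * ‖w‖) * ‖w‖ = inner ℝ u w / σ := by field_simp
  have h1 : {z : Pt D | Real.sign (inner ℝ (u + σ • z) w) ≠ 1} =
      {z | inner ℝ w z ≤ -(inner ℝ u w / (σ * ‖w‖) * ‖w‖)} := by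
    ext z
    simp only [Set.mem_ofPred_eq, hone, inner_add_left, real_inner_smul_left, ht,
      real_inner_comm z w, ← neg_div, le_div_iff₀ hσ]
    constructor <;> intro h <;> linarith
  have h2 : {z : Pt D | Real.sign (inner ℝ (-u + σ • z) w) ≠ -1} =
      {z | inner ℝ u w / (σ * ‖w‖) * ‖w‖ ≤ inner ℝ w z} := by
    ext z
    simp only [Set.mem_ofPred_eq, hneg, inner_add_left, inner_neg_left, real_inner_smul_left, ht,
      real_inner_comm z w, div_le_iff₀ hσ]
    constructor <;> intro h <;> linarith
  rw [newError, h1, h2, stdGaussian_inner_le hw, stdGaussian_inner_ge hw, two_mul]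

/-- The error probability of the linear classifier with direction `w` for a class center `u`;
in the degenerate case `w = 0` the trivial bound `1`. -/
noncomputable def linearError {D : ℕ} (σ : ℝ) (u w : Pt D) : ℝ≥0∞ :=
  if w = 0 then 1 else gaussianTail (inner ℝ u w / (σ * ‖w‖))

theorem newError_sign_le {D : ℕ} {σ : ℝ} (hσ : 0 < σ) (u w : Pt D) :
    2⁻¹ * newError σ (fun x => Real.sign (inner ℝ x w)) u ≤ linearError σ u w := by
  unfold linearError
  split_ifs with hw
  · have h : newError σ (fun x => Real.sign (inner ℝ x w)) u ≤ 2 :=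
      (add_le_add prob_le_one prob_le_one).trans one_add_one_eq_two.le
    refine (mul_le_mul_right h 2⁻¹).trans (ENNReal.inv_mul_cancel ?_ ?_).le <;> norm_num
  · rw [newError_sign hσ u hw, ← mul_assoc, ENNReal.inv_mul_cancel (by norm_num) (by norm_num),
      one_mul]

@[fun_prop]
theorem measurable_linearError {D : ℕ} (σ : ℝ) {X : Type*} [MeasurableSpace X] {u w : X → Pt D}
    (hu : Measurable u) (hw : Measurable w) : Measurable fun x => linearError σ (u x) (w x) := by
  unfold linearError
  exact Measurable.ite (hw (measurableSet_singleton 0)) measurable_const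
    (continuous_gaussianTail.measurable.comp ((hu.inner hw).div (hw.norm.const_mul σ)))

/-! ### Reduction to independent Gaussian vectors -/

/-- A signed sum of `k` independent standard Gaussian vectors has the law of `√k` times one such
vector, by comparison of characteristic functions. -/
theorem pi_stdGaussian_map_sum {D k : ℕ} (v : Fin k → ℝ) (hv : ∀ i, v i ^ 2 = 1) :
    (Measure.pi fun _ : Fin k => stdGaussian (Pt D)).map (fun z => ∑ i, v i • z i) =
      (stdGaussian (Pt D)).map (fun z => √k • z) := by
  apply Measure.ext_of_charFun
  ext τ
  have h2 : charFun ((stdGaussian (Pt D)).map (fun z => √k • z)) τ =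
      Complex.exp (-(k * ‖τ‖ ^ 2) / 2) := by
    rw [charFun_map_smul, charFun_stdGaussian, norm_smul, Real.norm_of_nonneg (Real.sqrt_nonneg _)]
    congr 2
    norm_cast
    rw [mul_pow, Real.sq_sqrt (Nat.cast_nonneg k)]
  have h3 : ∀ i, charFun (stdGaussian (Pt D)) (v i • τ) = Complex.exp (-‖τ‖ ^ 2 / 2) := fun i => by
    rw [charFun_stdGaussian, norm_smul]
    congr 3
    norm_cast
    rw [mul_pow, Real.norm_eq_abs, sq_abs, hv, one_mul]
  rw [h2, charFun_apply, integral_map (Measurable.aemeasurable (by fun_prop)) (by fun_prop)]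
  simp_rw [sum_inner, Complex.ofReal_sum, Finset.sum_mul, Complex.exp_sum, real_inner_smul_left,
    ← inner_smul_right]
  rw [integral_fintype_prod_eq_prod
    (f := fun i (z : Pt D) => Complex.exp ((inner ℝ z (v i • τ) : ℝ) * Complex.I))]
  simp_rw [← charFun_apply, h3]
  rw [Finset.prod_const, Finset.card_univ, Fintype.card_fin, ← Complex.exp_nat_mul]
  congr 1
  ring

theorem ae_sq_eq_one {T : ℕ} (n : Fin T → ℕ) :
    ∀ᵐ v ∂(Measure.pi fun s => Measure.pi fun _ : Fin (n s) => classLaw),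
      ∀ s i, v s i ^ 2 = 1 := by
  have h1 : ∀ᵐ x ∂classLaw, x ^ 2 = 1 := by
    rw [classLaw_eq, ae_add_measure_iff]
    constructor <;> refine Measure.ae_smul_measure ?_ _ <;> rw [ae_dirac_eq] <;> simp
  refine ae_all_iff.2 fun s => ae_all_iff.2 fun i => ?_
  have h2 : ∀ᵐ w ∂(Measure.pi fun _ : Fin (n s) => classLaw), w i ^ 2 = 1 :=
    (measurePreserving_eval (fun _ : Fin (n s) => classLaw) i).quasiMeasurePreserving.ae h1
  exact (measurePreserving_eval
    (fun s => Measure.pi fun _ : Fin (n s) => classLaw) s).quasiMeasurePreserving.ae h2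

/-- Multiplying a training point by its class turns the signal into the center itself, because
`v² = 1`. -/
theorem classMean_data {T D : ℕ} {n : Fin T → ℕ} (hn : ∀ s, n s ≠ 0) (σ : Fin T → ℝ)
    {v : ∀ s, Fin (n s) → ℝ} (hv : ∀ s i, v s i ^ 2 = 1) (u : Fin T → Pt D)
    (z : ∀ s, Fin (n s) → Pt D) :
    classMean v (fun s i => v s i • u s + σ s • z s i) = fun s =>
      u s + σ s • (n s : ℝ)⁻¹ • ∑ i, v s i • z s i := by
  funext s
  have h1 : ∀ i, v s i • (v s i • u s + σ s • z s i) = u s + σ s • (v s i • z s i) := fun i => by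
    rw [smul_add, smul_smul, ← sq, hv, one_smul, smul_comm]
  simp only [classMean, h1, Finset.sum_add_distrib, Finset.sum_const, Finset.card_univ,
    Fintype.card_fin, smul_add, ← Finset.smul_sum]
  rw [← Nat.cast_smul_eq_nsmul ℝ, smul_smul, inv_mul_cancel₀ (Nat.cast_ne_zero.2 (hn s)), one_smul,
    smul_comm]

/-- The law of two independent `T`-tuples of independent standard Gaussian vectors: the first one
drives the centers, the second one the class means. -/
noncomputable def pairLaw (T D : ℕ) : Measure ((Fin T → Pt D) × (Fin T → Pt D)) :=
  (Measure.pi fun _ : Fin T => stdGaussian (Pt D)).prod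
    (Measure.pi fun _ : Fin T => stdGaussian (Pt D))

instance (T D : ℕ) : IsProbabilityMeasure (pairLaw T D) := by
  unfold pairLaw; infer_instance

/-- The class means `U_s + σ_s n_s^{-1/2} G_s`, where the first tuple of `p` drives the centers `U`
and the second one is `G`. -/
noncomputable def gaussianMean {T D : ℕ} (C : Matrix (Fin T) (Fin T) ℝ) (σ : Fin T → ℝ)
    (n : Fin T → ℕ) (p : (Fin T → Pt D) × (Fin T → Pt D)) (s : Fin T) : Pt D :=
  centers C p.1 s + (σ s * (√(n s))⁻¹) • p.2 s

/-- The centers and the class means have the same joint law in the model and in terms of `2 T`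
independent standard Gaussian vectors. -/
theorem lintegral_model_classMean {T D : ℕ} {n : Fin T → ℕ} (hn : ∀ s, n s ≠ 0)
    (C : Matrix (Fin T) (Fin T) ℝ) (σ : Fin T → ℝ)
    {F : (Fin T → Pt D) → (Fin T → Pt D) → ℝ≥0∞}
    (hF : Measurable fun p : (Fin T → Pt D) × (Fin T → Pt D) => F p.1 p.2) :
    ∫⁻ v, ∫⁻ u, ∫⁻ z, F u (classMean v fun s i => v s i • u s + σ s • z s i)
        ∂noiseLaw n D ∂centerLaw C D
        ∂(Measure.pi fun s => Measure.pi fun _ : Fin (n s) => classLaw) =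
      ∫⁻ p, F (centers C p.1) (gaussianMean C σ n p) ∂pairLaw T D := by
  have hFu : ∀ u : Fin T → Pt D, Measurable fun m => F u m := fun u =>
    hF.comp (by fun_prop : Measurable fun m : Fin T → Pt D => (u, m))
  have key : ∀ v : ∀ s, Fin (n s) → ℝ, (∀ s i, v s i ^ 2 = 1) → ∀ u : Fin T → Pt D,
      ∫⁻ z, F u (classMean v fun s i => v s i • u s + σ s • z s i) ∂noiseLaw n D =
        ∫⁻ G, F u (fun s => u s + (σ s * (√(n s))⁻¹) • G s)
          ∂Measure.pi fun _ : Fin T => stdGaussian (Pt D) := fun v hv u => by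
    simp_rw [classMean_data hn σ hv]
    have hm1 : ∀ s, Measurable fun z : Fin (n s) → Pt D => ∑ i, v s i • z i := fun s => by fun_prop
    have hm2 : ∀ s, Measurable fun z : Pt D => √(n s) • z := fun s => by fun_prop
    have hP1 : ∀ s, IsProbabilityMeasure ((Measure.pi fun _ : Fin (n s) => stdGaussian (Pt D)).map
        fun z => ∑ i, v s i • z i) := fun s =>
      Measure.isProbabilityMeasure_map (hm1 s).aemeasurable
    have hP2 : ∀ s, IsProbabilityMeasure ((stdGaussian (Pt D)).map fun z => √(n s) • z) := fun s =>
      Measure.isProbabilityMeasure_map (hm2 s).aemeasurable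
    have h1 := Measure.pi_map_pi (μ := fun s => Measure.pi fun _ : Fin (n s) => stdGaussian (Pt D))
      (f := fun s z => ∑ i, v s i • z i) fun s => (hm1 s).aemeasurable
    have h2 := Measure.pi_map_pi (μ := fun _ : Fin T => stdGaussian (Pt D))
      (f := fun s z => √(n s) • z) fun s => (hm2 s).aemeasurable
    simp_rw [pi_stdGaussian_map_sum _ (hv _)] at h1
    have hF' : Measurable fun S : Fin T → Pt D => F u fun s => u s + σ s • (n s : ℝ)⁻¹ • S s :=
      (hFu u).comp (by fun_prop : Measurable fun (S : Fin T → Pt D) s =>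
        u s + σ s • (n s : ℝ)⁻¹ • S s)
    have h3 := lintegral_map (μ := noiseLaw n D) hF' (g := fun z s => ∑ i, v s i • z s i)
      (by fun_prop)
    have h4 := lintegral_map (μ := Measure.pi fun _ : Fin T => stdGaussian (Pt D)) hF'
      (g := fun G s => √(n s) • G s) (by fun_prop)
    rw [← h3, h1, ← h2, h4]
    refine lintegral_congr fun G => ?_
    congr 1
    funext s
    rw [smul_smul, smul_smul]
    congr 2
    rw [mul_assoc, ← div_eq_inv_mul, Real.sqrt_div_self]
  have hcm : Measurable fun p : (Fin T → Pt D) × (Fin T → Pt D) =>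
      (p.1, fun s => p.1 s + (σ s * (√(n s))⁻¹) • p.2 s) := by fun_prop
  have hFG : Measurable fun p : (Fin T → Pt D) × (Fin T → Pt D) =>
      F p.1 (fun s => p.1 s + (σ s * (√(n s))⁻¹) • p.2 s) := hF.comp hcm
  have hc1 : Measurable fun p : (Fin T → Pt D) × (Fin T → Pt D) => (centers C p.1, p.2) :=
    ((measurable_centers C).comp measurable_fst).prodMk measurable_snd
  have hFc : Measurable fun p : (Fin T → Pt D) × (Fin T → Pt D) =>
      F (centers C p.1) (fun s => centers C p.1 s + (σ s * (√(n s))⁻¹) • p.2 s) := hFG.comp hc1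
  have hint : Measurable fun u : Fin T → Pt D =>
      ∫⁻ G, F u (fun s => u s + (σ s * (√(n s))⁻¹) • G s)
          ∂Measure.pi fun _ : Fin T => stdGaussian (Pt D) := hFG.lintegral_prod_right'
  have hv : ∀ᵐ v ∂(Measure.pi fun s => Measure.pi fun _ : Fin (n s) => classLaw),
      ∫⁻ u, ∫⁻ z, F u (classMean v fun s i => v s i • u s + σ s • z s i)
        ∂noiseLaw n D ∂centerLaw C D =
      ∫⁻ p, F (centers C p.1) (gaussianMean C σ n p) ∂pairLaw T D := by
    filter_upwards [ae_sq_eq_one n] with v hv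
    rw [lintegral_congr fun u => key v hv u, lintegral_centerLaw C hint, pairLaw]
    exact (lintegral_prod _ hFc.aemeasurable).symm
  rw [lintegral_congr_ae hv, lintegral_const, measure_univ, mul_one]

/-! ### The two bounds on the risk -/

theorem measurable_algorithm {T D : ℕ} (C : Matrix (Fin T) (Fin T) ℝ) (σ α : Fin T → ℝ)
    (n : Fin T → ℕ) (t : Fin T) : Measurable (algorithm C σ α n D t) := by
  have hs : Measurable Real.sign := by
    unfold Real.sign
    exact Measurable.ite measurableSet_Iio measurable_const
      (Measurable.ite measurableSet_Ioi measurable_const measurable_const)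
  unfold algorithm combinedMean classMean
  exact hs.comp (by fun_prop)

theorem ofReal_risk {T D : ℕ} {n : Fin T → ℕ} (C : Matrix (Fin T) (Fin T) ℝ) (σ : Fin T → ℝ)
    (t : Fin T) (f : Obs T n D → ℝ) :
    ENNReal.ofReal (risk C σ n D t f) = modelLaw C n D (misclassified σ t f) := by
  have : IsProbabilityMeasure (modelLaw C n D) := by unfold modelLaw; infer_instance
  exact ofReal_measureReal

theorem lintegral_oracleError_le_risk {T D : ℕ} {n : Fin T → ℕ} (hn : ∀ s, n s ≠ 0)
    (C : Matrix (Fin T) (Fin T) ℝ) {σ : Fin T → ℝ} (hσ : ∀ s, 0 < σ s) (t : Fin T)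
    {f : Obs T n D → ℝ} (hf : Measurable f) :
    ∫⁻ p, oracleError (σ t) (centers C p.1 t) (gaussianMean C σ n p) ∂pairLaw T D ≤
      ENNReal.ofReal (risk C σ n D t f) := by
  rw [ofReal_risk]
  refine le_trans (le_of_eq ?_) (oracleError_le_modelLaw C hσ t hf)
  exact (lintegral_model_classMean hn C σ (F := fun u m => oracleError (σ t) (u t) m)
    (by fun_prop)).symm

theorem risk_algorithm_le {T D : ℕ} {n : Fin T → ℕ} (hn : ∀ s, n s ≠ 0)
    (C : Matrix (Fin T) (Fin T) ℝ) {σ : Fin T → ℝ} (hσ : ∀ s, 0 < σ s) (α : Fin T → ℝ)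
    (t : Fin T) :
    ENNReal.ofReal (risk C σ n D t (algorithm C σ α n D t)) ≤
      ∫⁻ p, linearError (σ t) (centers C p.1 t)
        (∑ s, (weights C σ α t s * (σ s)⁻¹) • gaussianMean C σ n p s) ∂pairLaw T D := by
  rw [ofReal_risk, modelLaw_misclassified C σ t (measurable_algorithm C σ α n t)]
  refine le_trans ?_ (lintegral_model_classMean hn C σ (F := fun u m => linearError (σ t) (u t)
    (∑ s, (weights C σ α t s * (σ s)⁻¹) • m s)) (by fun_prop)).le
  refine lintegral_mono fun v => lintegral_mono fun u => lintegral_mono fun z => ?_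
  have h := newError_sign_le (hσ t) (u t) (∑ s, (weights C σ α t s * (σ s)⁻¹) •
    classMean v (fun s i => v s i • u s + σ s • z s i) s)
  simpa only [algorithm, combinedMean, smul_smul] using h

/-! ### Convergence in probability along a sequence of probability spaces -/

section Whp

variable {Ω : ℕ → Type*} [∀ D, MeasurableSpace (Ω D)]

/-- The filter of the events that happen with high probability: the measure of the complement in
the `D`-th space tends to `0` (outer measure, so that no measurability is involved).  A real
function on `Σ D, Ω D` converges along this filter iff it converges in probability. -/
def whp (μ : ∀ D, Measure (Ω D)) : Filter (Σ D, Ω D) where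
  sets := {S | Tendsto (fun D => μ D {p | (⟨D, p⟩ : Σ D, Ω D) ∉ S}) atTop (𝓝 0)}
  univ_sets := by simp
  sets_of_superset := fun {S S'} hS h => tendsto_of_tendsto_of_tendsto_of_le_of_le
    tendsto_const_nhds hS (fun _ => zero_le) fun D => measure_mono fun _ hp hp' => hp (h hp')
  inter_sets := fun {S S'} hS hS' => by
    have h : Tendsto (fun D => μ D {p | (⟨D, p⟩ : Σ D, Ω D) ∉ S} +
        μ D {p | (⟨D, p⟩ : Σ D, Ω D) ∉ S'}) atTop (𝓝 0) := by
      have := Tendsto.add (Set.mem_ofPred_eq ▸ hS) (Set.mem_ofPred_eq ▸ hS')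
      rwa [add_zero] at this
    refine tendsto_of_tendsto_of_tendsto_of_le_of_le tendsto_const_nhds h (fun _ => zero_le)
      fun D => (measure_mono fun p hp => ?_).trans (measure_union_le _ _)
    by_cases hp' : (⟨D, p⟩ : Σ D, Ω D) ∈ S
    · exact Or.inr fun h' => hp ⟨hp', h'⟩
    · exact Or.inl hp'

variable {μ : ∀ D, Measure (Ω D)}

theorem eventually_whp {P : (Σ D, Ω D) → Prop} :
    (∀ᶠ p in whp μ, P p) ↔ Tendsto (fun D => μ D {p | ¬ P ⟨D, p⟩}) atTop (𝓝 0) := Iff.rfl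

theorem tendsto_fst_whp : Tendsto Sigma.fst (whp μ) atTop := by
  refine tendsto_atTop.2 fun k => eventually_whp.2 ?_
  refine tendsto_const_nhds.congr' ?_
  filter_upwards [eventually_ge_atTop k] with D hD
  simp [hD]

/-- Bounded convergence: functions with values in `[0, 1]` that converge in probability to a
constant have convergent integrals. -/
theorem tendsto_lintegral_of_whp [∀ D, IsProbabilityMeasure (μ D)] {φ : (Σ D, Ω D) → ℝ≥0∞}
    (hφ : ∀ p, φ p ≤ 1) {L : ℝ≥0∞} (hL : L ≤ 1) (h : Tendsto φ (whp μ) (𝓝 L)) :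
    Tendsto (fun D => ∫⁻ p, φ ⟨D, p⟩ ∂μ D) atTop (𝓝 L) := by
  have hL' : L ≠ ∞ := (hL.trans_lt ENNReal.one_lt_top).ne
  rw [ENNReal.tendsto_nhds hL'] at h ⊢
  intro ε hε
  have hε' : 0 < ε / 2 := ENNReal.half_pos hε.ne'
  have h1 := eventually_whp.1 (h (ε / 2) hε')
  filter_upwards [h1.eventually (ge_mem_nhds hε')] with D hD
  -- a measurable bad event, outside of which `φ` is within `ε / 2` of its limit
  set B : Set (Ω D) := toMeasurable (μ D) {p | ¬ φ ⟨D, p⟩ ∈ Set.Icc (L - ε / 2) (L + ε / 2)}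
    with hB
  have hBm : MeasurableSet B := measurableSet_toMeasurable _ _
  have hBε : μ D B ≤ ε / 2 := (measure_toMeasurable _).trans_le hD
  have hgood : ∀ p, p ∉ B → φ ⟨D, p⟩ ∈ Set.Icc (L - ε / 2) (L + ε / 2) := fun p hp => by
    by_contra hp'
    exact hp (subset_toMeasurable _ _ hp')
  have hind : ∫⁻ p, B.indicator 1 p ∂μ D = μ D B := lintegral_indicator_one hBm
  have hm1 : Measurable (B.indicator (1 : Ω D → ℝ≥0∞)) := measurable_one.indicator hBm
  constructor
  · have h2 : ∫⁻ _, (L - ε / 2) ∂μ D ≤ ∫⁻ p, φ ⟨D, p⟩ ∂μ D + μ D B := by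
      rw [← hind, ← lintegral_add_right _ hm1]
      refine lintegral_mono fun p => ?_
      by_cases hp : p ∈ B
      · simp only [Set.indicator_of_mem hp, Pi.one_apply]
        exact tsub_le_self.trans (hL.trans le_add_self)
      · exact (hgood p hp).1.trans le_self_add
    rw [lintegral_const, measure_univ, mul_one, tsub_le_iff_right, add_assoc] at h2
    rw [tsub_le_iff_right]
    refine h2.trans (add_le_add le_rfl ?_)
    exact (add_le_add hBε le_rfl).trans (ENNReal.add_halves ε).le
  · have h2 : ∫⁻ p, φ ⟨D, p⟩ ∂μ D ≤ ∫⁻ _, (L + ε / 2) ∂μ D + μ D B := by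
      rw [← hind, ← lintegral_add_right _ hm1]
      refine lintegral_mono fun p => ?_
      by_cases hp : p ∈ B
      · simp only [Set.indicator_of_mem hp, Pi.one_apply]
        exact (hφ _).trans le_add_self
      · exact (hgood p hp).2.trans le_self_add
    rw [lintegral_const, measure_univ, mul_one, add_assoc] at h2
    refine h2.trans (add_le_add le_rfl ?_)
    exact (add_le_add le_rfl hBε).trans (ENNReal.add_halves ε).le

/-- Chebyshev's inequality as a criterion for convergence in probability to `0`. -/
theorem tendsto_div_whp_of_lintegral_le {X : ∀ D, Ω D → ℝ} (hX : ∀ D, Measurable (X D))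
    {a c : ℕ → ℝ} (ha : ∀ D, ∫⁻ p, ‖X D p‖ₑ ^ 2 ∂μ D ≤ ENNReal.ofReal (a D))
    (hac : Tendsto (fun D => a D / c D ^ 2) atTop (𝓝 0)) :
    Tendsto (fun p : Σ D, Ω D => X p.1 p.2 / c p.1) (whp μ) (𝓝 0) := by
  rw [Metric.tendsto_nhds]
  intro ε hε
  refine eventually_whp.2 ?_
  have hlim : Tendsto (fun D => ENNReal.ofReal (a D / c D ^ 2) / ENNReal.ofReal (ε ^ 2)) atTop
      (𝓝 0) := by
    have h := ENNReal.Tendsto.div_const (ENNReal.tendsto_ofReal hac)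
      (b := ENNReal.ofReal (ε ^ 2)) (Or.inr (by positivity))
    simpa using h
  refine tendsto_of_tendsto_of_tendsto_of_le_of_le tendsto_const_nhds hlim (fun _ => zero_le)
    fun D => ?_
  have h1 : ∫⁻ p, ‖X D p / c D‖ₑ ^ 2 ∂μ D ≤ ENNReal.ofReal (a D / c D ^ 2) := by
    have e : ∀ p, ‖X D p / c D‖ₑ ^ 2 = ENNReal.ofReal ((c D ^ 2)⁻¹) * ‖X D p‖ₑ ^ 2 := fun p => by
      rw [Real.enorm_eq_ofReal_abs, Real.enorm_eq_ofReal_abs, ← ENNReal.ofReal_pow (abs_nonneg _),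
        ← ENNReal.ofReal_pow (abs_nonneg _), ← ENNReal.ofReal_mul (by positivity), sq_abs, sq_abs,
        div_pow, div_eq_inv_mul]
    simp_rw [e]
    rw [lintegral_const_mul' _ _ ENNReal.ofReal_ne_top, div_eq_inv_mul,
      ENNReal.ofReal_mul (by positivity)]
    exact mul_le_mul_right (ha D) _
  have hm : Measurable fun p => ‖X D p / c D‖ₑ ^ 2 := ((hX D).div_const _).enorm.pow_const 2
  refine le_trans (measure_mono fun p hp => ?_) ((meas_ge_le_lintegral_div hm.aemeasurable
    (by positivity) ENNReal.ofReal_ne_top).trans (ENNReal.div_le_div_right h1 _))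
  simp only [Set.mem_ofPred_eq, Real.dist_eq, sub_zero, not_lt] at hp ⊢
  rw [Real.enorm_eq_ofReal_abs, ← ENNReal.ofReal_pow (abs_nonneg _)]
  exact ENNReal.ofReal_le_ofReal (pow_le_pow_left₀ hε.le hp 2)

end Whp

/-! ### Second moments of Gaussian vectors -/

theorem lintegral_inner_sq {D : ℕ} (u : Pt D) :
    ∫⁻ z, ‖(inner ℝ u z : ℝ)‖ₑ ^ 2 ∂stdGaussian (Pt D) = ‖u‖ₑ ^ 2 := by
  have h1 : MemLp (innerSL ℝ u) 2 (stdGaussian (Pt D)) :=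
    (innerSL ℝ u).comp_memLp' IsGaussian.memLp_two_id
  have h2 := h1.ofReal_variance_eq
  rw [variance_dual_stdGaussian, innerSL_apply_norm, evariance,
    integral_strongDual_stdGaussian] at h2
  simp only [sub_zero, innerSL_apply_apply] at h2
  rw [← h2, ENNReal.ofReal_pow (norm_nonneg _), ofReal_norm]

theorem memLp_sq_gaussianReal : MemLp (fun x : ℝ => x ^ 2) 2 (gaussianReal 0 1) := by
  refine (memLp_two_iff_integrable_sq (by fun_prop)).2 ?_
  have h := (memLp_id_gaussianReal (μ := 0) (v := 1) 4).integrable_norm_pow (p := 4) (by norm_num)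
  refine h.congr (Eventually.of_forall fun x => ?_)
  simp only [id, Real.norm_eq_abs, ← pow_mul]
  exact Even.pow_abs (by decide) x

theorem integral_sq_gaussianReal : ∫ x, x ^ 2 ∂gaussianReal 0 1 = 1 := by
  have h := variance_of_integral_eq_zero (μ := gaussianReal 0 1) (X := id)
    measurable_id.aemeasurable (by simp)
  rw [variance_id_gaussianReal] at h
  simpa using h.symm

theorem measurable_toLp (D : ℕ) : Measurable (WithLp.toLp 2 : (Fin D → ℝ) → Pt D) := by
  fun_prop

theorem integral_norm_sq_stdGaussian (D : ℕ) :
    ∫ z, ‖z‖ ^ 2 ∂stdGaussian (Pt D) = D := by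
  rw [← map_pi_eq_stdGaussian, integral_map (measurable_toLp D).aemeasurable (by fun_prop)]
  simp only [EuclideanSpace.real_norm_sq_eq]
  rw [integral_finsetSum _ fun i _ => integrable_comp_eval
    (μ := fun _ : Fin D => gaussianReal 0 1) (f := fun x : ℝ => x ^ 2)
    (memLp_sq_gaussianReal.integrable (by norm_num))]
  have h : ∀ i : Fin D, ∫ x : Fin D → ℝ, x i ^ 2 ∂Measure.pi (fun _ => gaussianReal 0 1) = 1 :=
    fun i => by
      rw [integral_comp_eval (μ := fun _ : Fin D => gaussianReal 0 1) (f := fun x : ℝ => x ^ 2)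
        (by fun_prop), integral_sq_gaussianReal]
  simp [h]

theorem memLp_norm_sq_stdGaussian (D : ℕ) :
    MemLp (fun z : Pt D => ‖z‖ ^ 2) 2 (stdGaussian (Pt D)) := by
  rw [← map_pi_eq_stdGaussian, memLp_map_measure_iff (by fun_prop) (measurable_toLp D).aemeasurable]
  have h : (fun z : Pt D => ‖z‖ ^ 2) ∘ WithLp.toLp 2 = fun x : Fin D → ℝ => ∑ i, x i ^ 2 := by
    funext x
    simp [EuclideanSpace.real_norm_sq_eq]
  rw [h]
  exact memLp_finsetSum _ fun i _ => memLp_sq_gaussianReal.comp_measurePreserving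
    (measurePreserving_eval (fun _ : Fin D => gaussianReal 0 1) i)

theorem variance_norm_sq_stdGaussian (D : ℕ) :
    Var[fun z => ‖z‖ ^ 2; stdGaussian (Pt D)] = Var[fun x => x ^ 2; gaussianReal 0 1] * D := by
  rw [← map_pi_eq_stdGaussian, variance_map (by fun_prop) (measurable_toLp D).aemeasurable]
  have h : (fun z : Pt D => ‖z‖ ^ 2) ∘ WithLp.toLp 2 =
      ∑ i, fun x : Fin D → ℝ => x i ^ 2 := by
    funext x
    simp [EuclideanSpace.real_norm_sq_eq]
  rw [h, variance_sum_pi (X := fun _ x => x ^ 2) fun _ => memLp_sq_gaussianReal]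
  simp [mul_comm]

theorem lintegral_norm_sq_stdGaussian (D : ℕ) :
    ∫⁻ z, ‖z‖ₑ ^ 2 ∂stdGaussian (Pt D) = ENNReal.ofReal D := by
  rw [← integral_norm_sq_stdGaussian, ofReal_integral_eq_lintegral_ofReal
    ((memLp_norm_sq_stdGaussian D).integrable (by norm_num))
    (Eventually.of_forall fun z => by positivity)]
  simp only [ENNReal.ofReal_pow (norm_nonneg _), ofReal_norm]

theorem lintegral_norm_sq_sub_sq (D : ℕ) :
    ∫⁻ z, ‖‖z‖ ^ 2 - (D : ℝ)‖ₑ ^ 2 ∂stdGaussian (Pt D) =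
      ENNReal.ofReal (Var[fun x => x ^ 2; gaussianReal 0 1] * D) := by
  rw [← variance_norm_sq_stdGaussian, (memLp_norm_sq_stdGaussian D).ofReal_variance_eq, evariance,
    integral_norm_sq_stdGaussian]

theorem lintegral_inner_sq_pi {T D : ℕ} {s r : Fin T} (h : s ≠ r) :
    ∫⁻ g, ‖(inner ℝ (g s) (g r) : ℝ)‖ₑ ^ 2 ∂(Measure.pi fun _ : Fin T => stdGaussian (Pt D)) =
      ENNReal.ofReal D := by
  have hi := (iIndepFun_pi (μ := fun _ : Fin T => stdGaussian (Pt D)) (X := fun _ z => z)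
    fun _ => aemeasurable_id).indepFun h
  rw [indepFun_iff_map_prod_eq_prod_map_map
    (measurable_pi_apply s).aemeasurable (measurable_pi_apply r).aemeasurable] at hi
  have he : ∀ s, (Measure.pi fun _ : Fin T => stdGaussian (Pt D)).map (fun g => g s) =
      stdGaussian (Pt D) := fun s =>
    (measurePreserving_eval (fun _ : Fin T => stdGaussian (Pt D)) s).map_eq
  rw [he, he] at hi
  have hF : Measurable fun p : Pt D × Pt D => ‖(inner ℝ p.1 p.2 : ℝ)‖ₑ ^ 2 := by fun_prop
  rw [← lintegral_map (g := fun g : Fin T → Pt D => (g s, g r)) hF (by fun_prop), hi,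
    lintegral_prod _ hF.aemeasurable, ← lintegral_norm_sq_stdGaussian]
  exact lintegral_congr fun x => lintegral_inner_sq x

theorem lintegral_norm_sq_sub_sq_pi {T D : ℕ} (s : Fin T) :
    ∫⁻ g, ‖(inner ℝ (g s) (g s) : ℝ) - D‖ₑ ^ 2
        ∂(Measure.pi fun _ : Fin T => stdGaussian (Pt D)) =
      ENNReal.ofReal (Var[fun x => x ^ 2; gaussianReal 0 1] * D) := by
  rw [← lintegral_norm_sq_sub_sq]
  simp only [real_inner_self_eq_norm_sq]
  exact (measurePreserving_eval (fun _ : Fin T => stdGaussian (Pt D)) s).lintegral_comp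
    (f := fun z => ‖‖z‖ ^ 2 - (D : ℝ)‖ₑ ^ 2) (by fun_prop)

theorem norm_centers_le {T D : ℕ} (C : Matrix (Fin T) (Fin T) ℝ) (g : Fin T → Pt D)
    (s : Fin T) : ‖centers C g s‖ ≤ ∑ r, |CFC.sqrt C r s| := by
  refine (norm_sum_le _ _).trans (Finset.sum_le_sum fun r _ => ?_)
  rw [norm_smul, Real.norm_eq_abs]
  refine mul_le_of_le_one_right (abs_nonneg _) ?_
  by_cases h : InnerProductSpace.gramSchmidtNormed ℝ g r = 0
  · simp [h]
  · exact (InnerProductSpace.gramSchmidtNormed_unit_length' h).le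

theorem lintegral_inner_centers_sq_le {T D : ℕ} (C : Matrix (Fin T) (Fin T) ℝ) (s r : Fin T) :
    ∫⁻ p, ‖(inner ℝ (centers C p.1 s) (p.2 r) : ℝ)‖ₑ ^ 2 ∂pairLaw T D ≤
      ENNReal.ofReal ((∑ r, |CFC.sqrt C r s|) ^ 2) := by
  have hc : Measurable fun p : (Fin T → Pt D) × (Fin T → Pt D) => centers C p.1 s :=
    (measurable_pi_apply s).comp ((measurable_centers C).comp measurable_fst)
  have hF : Measurable fun p : (Fin T → Pt D) × (Fin T → Pt D) =>
      ‖(inner ℝ (centers C p.1 s) (p.2 r) : ℝ)‖ₑ ^ 2 := by fun_prop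
  rw [pairLaw, lintegral_prod _ hF.aemeasurable]
  have h1 : ∀ g : Fin T → Pt D, ∫⁻ G, ‖(inner ℝ (centers C g s) (G r) : ℝ)‖ₑ ^ 2
      ∂(Measure.pi fun _ : Fin T => stdGaussian (Pt D)) ≤
        ENNReal.ofReal ((∑ r, |CFC.sqrt C r s|) ^ 2) := fun g => by
    have h2 := (measurePreserving_eval (fun _ : Fin T => stdGaussian (Pt D)) r).lintegral_comp
      (f := fun z => ‖(inner ℝ (centers C g s) z : ℝ)‖ₑ ^ 2) (by fun_prop)
    refine (h2.trans (lintegral_inner_sq _)).trans_le ?_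
    rw [← ofReal_norm, ← ENNReal.ofReal_pow (norm_nonneg _)]
    exact ENNReal.ofReal_le_ofReal (pow_le_pow_left₀ (norm_nonneg _) (norm_centers_le C g s) 2)
  refine (lintegral_mono h1).trans ?_
  rw [lintegral_const, measure_univ, mul_one]

/-! ### High-dimensional limits of the Gram matrices -/

/-- A dimension together with a value of the `2 T` Gaussian vectors in that dimension. -/
abbrev Sample (T : ℕ) : Type := Σ D : ℕ, (Fin T → Pt D) × (Fin T → Pt D)

theorem tendsto_const_mul_div_sq (κ : ℝ) :
    Tendsto (fun D : ℕ => κ * D / (D : ℝ) ^ 2) atTop (𝓝 0) := by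
  refine (tendsto_const_div_atTop_nhds_zero_nat κ).congr fun D => ?_
  rcases eq_or_ne (D : ℝ) 0 with h | h
  · simp [h]
  · field_simp

/-- Independent standard Gaussian vectors of `ℝ^D`, scaled by `1 / √D`, are asymptotically
orthonormal.  The map `π` selects one of the two tuples. -/
theorem tendsto_gram_div {T : ℕ} {π : ∀ D, (Fin T → Pt D) × (Fin T → Pt D) → Fin T → Pt D}
    (hπ : ∀ D, MeasurePreserving (π D) (pairLaw T D) (Measure.pi fun _ => stdGaussian (Pt D)))
    (s r : Fin T) :
    Tendsto (fun p : Sample T => (inner ℝ (π p.1 p.2 s) (π p.1 p.2 r) : ℝ) / p.1)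
      (whp (pairLaw T)) (𝓝 ((1 : Matrix (Fin T) (Fin T) ℝ) s r)) := by
  have hm : ∀ D s, Measurable fun p => π D p s := fun D s =>
    (measurable_pi_apply s).comp (hπ D).measurable
  rcases eq_or_ne s r with rfl | h
  · have h1 := tendsto_div_whp_of_lintegral_le (μ := pairLaw T)
      (X := fun D p => inner ℝ (π D p s) (π D p s) - (D : ℝ)) (fun D => by fun_prop)
      (fun D => (((hπ D).lintegral_comp (f := fun g : Fin T → Pt D =>
        ‖(inner ℝ (g s) (g s) : ℝ) - D‖ₑ ^ 2) (by fun_prop)).trans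
          (lintegral_norm_sq_sub_sq_pi s)).le) (tendsto_const_mul_div_sq _)
    rw [Matrix.one_apply_eq]
    have h2 := h1.add_const 1
    rw [zero_add] at h2
    refine h2.congr' ?_
    filter_upwards [tendsto_fst_whp.eventually (eventually_gt_atTop 0)] with p hp
    have hp' : (p.1 : ℝ) ≠ 0 := Nat.cast_ne_zero.2 hp.ne'
    rw [sub_div, div_self hp', sub_add_cancel]
  · rw [Matrix.one_apply_ne h]
    refine tendsto_div_whp_of_lintegral_le (μ := pairLaw T)
      (X := fun D p => inner ℝ (π D p s) (π D p r)) (a := fun D => 1 * (D : ℝ))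
      (fun D => by fun_prop) (fun D => ?_) (tendsto_const_mul_div_sq 1)
    rw [one_mul]
    exact (((hπ D).lintegral_comp (f := fun g : Fin T → Pt D =>
        ‖(inner ℝ (g s) (g r) : ℝ)‖ₑ ^ 2) (by fun_prop)).trans
          (lintegral_inner_sq_pi h)).le

/-- The normalised Gram matrix of the vectors fed to the Gram-Schmidt process tends to the identity,
so these vectors are linearly independent with high probability, and then the centers have Gram
matrix `C`. -/
theorem eventually_inner_centers {T : ℕ} {C : Matrix (Fin T) (Fin T) ℝ} (hC : C.PosSemidef) :
    ∀ᶠ p : Sample T in whp (pairLaw T), ∀ s r,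
      (inner ℝ (centers C p.2.1 s) (centers C p.2.1 r) : ℝ) = C s r := by
  have h1 : Tendsto (fun p : Sample T => (p.1 : ℝ)⁻¹ • Matrix.gram ℝ p.2.1) (whp (pairLaw T))
      (𝓝 1) := by
    refine tendsto_pi_nhds.2 fun s => tendsto_pi_nhds.2 fun r => ?_
    refine (tendsto_gram_div (π := fun D p => p.1) (fun D => measurePreserving_fst) s r).congr
      fun p => ?_
    simp [div_eq_inv_mul]
  have h2 := ((Continuous.matrix_det continuous_id).tendsto (1 : Matrix (Fin T) (Fin T) ℝ)).comp h1
  rw [id, Matrix.det_one] at h2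
  filter_upwards [h2.eventually_ne one_ne_zero] with p hp
  simp only [Function.comp_apply, id, Matrix.det_smul] at hp
  exact inner_centers hC (Matrix.linearIndependent_of_det_gram_ne_zero (right_ne_zero_of_mul hp))

theorem tendsto_inner_centers_div_sqrt {T : ℕ} (C : Matrix (Fin T) (Fin T) ℝ) (s r : Fin T) :
    Tendsto (fun p : Sample T => (inner ℝ (centers C p.2.1 s) (p.2.2 r) : ℝ) / √p.1)
      (whp (pairLaw T)) (𝓝 0) := by
  have hc : ∀ D, Measurable fun p : (Fin T → Pt D) × (Fin T → Pt D) => centers C p.1 s := fun D =>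
    (measurable_pi_apply s).comp ((measurable_centers C).comp measurable_fst)
  refine tendsto_div_whp_of_lintegral_le (μ := pairLaw T)
    (X := fun D p => inner ℝ (centers C p.1 s) (p.2 r)) (c := fun D => √(D : ℝ))
    (fun D => by have := hc D; fun_prop) (fun D => lintegral_inner_centers_sq_le C s r) ?_
  simp only [Real.sq_sqrt (Nat.cast_nonneg _)]
  exact tendsto_const_div_atTop_nhds_zero_nat _

/-- The limit `C + diag(σ² / α)` of the Gram matrix of the class means. -/
noncomputable def limitGram {T : ℕ} (C : Matrix (Fin T) (Fin T) ℝ) (σ α : Fin T → ℝ) :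
    Matrix (Fin T) (Fin T) ℝ :=
  C + Matrix.diagonal fun s => σ s ^ 2 / α s

section Limits

variable {T : ℕ} {C : Matrix (Fin T) (Fin T) ℝ} {σ α : Fin T → ℝ} {N : ℕ → Fin T → ℕ}

/-- The noise of the class means has length of order `σ_s √(D / N_s)`. -/
theorem tendsto_noise_scale (hα : ∀ s, 0 < α s)
    (hN : ∀ s, Tendsto (fun D : ℕ => (N D s : ℝ) / (D : ℝ)) atTop (𝓝 (α s))) (s : Fin T) :
    Tendsto (fun p : Sample T => σ s * (√(N p.1 s))⁻¹ * √p.1) (whp (pairLaw T))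
      (𝓝 (σ s * (√(α s))⁻¹)) := by
  have h1 : Tendsto (fun D : ℕ => σ s * (√((N D s : ℝ) / (D : ℝ)))⁻¹) atTop
      (𝓝 (σ s * (√(α s))⁻¹)) :=
    ((hN s).sqrt.inv₀ (Real.sqrt_ne_zero'.2 (hα s))).const_mul _
  refine (h1.comp tendsto_fst_whp).congr fun p => ?_
  simp only [Function.comp_apply]
  rw [Real.sqrt_div' _ (Nat.cast_nonneg _), inv_div, div_eq_inv_mul, mul_assoc]

theorem tendsto_inner_center_mean (hC : C.PosSemidef) (hα : ∀ s, 0 < α s)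
    (hN : ∀ s, Tendsto (fun D : ℕ => (N D s : ℝ) / (D : ℝ)) atTop (𝓝 (α s))) (s r : Fin T) :
    Tendsto (fun p : Sample T =>
      (inner ℝ (centers C p.2.1 s) (gaussianMean C σ (N p.1) p.2 r) : ℝ))
      (whp (pairLaw T)) (𝓝 (C s r)) := by
  have h1 := ((tendsto_noise_scale (σ := σ) hα hN r).mul
    (tendsto_inner_centers_div_sqrt C s r)).const_add (C s r)
  rw [mul_zero, add_zero] at h1
  refine h1.congr' ?_
  filter_upwards [eventually_inner_centers hC,
    tendsto_fst_whp.eventually (eventually_gt_atTop 0)] with p hp hD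
  have hD' : √(p.1 : ℝ) ≠ 0 := Real.sqrt_ne_zero'.2 (Nat.cast_pos.2 hD)
  rw [gaussianMean, inner_add_right, hp, inner_smul_right]
  field_simp

theorem tendsto_gram_mean (hC : C.PosSemidef) (hα : ∀ s, 0 < α s)
    (hN : ∀ s, Tendsto (fun D : ℕ => (N D s : ℝ) / (D : ℝ)) atTop (𝓝 (α s))) :
    Tendsto (fun p : Sample T => Matrix.gram ℝ (gaussianMean C σ (N p.1) p.2))
      (whp (pairLaw T)) (𝓝 (limitGram C σ α)) := by
  refine tendsto_pi_nhds.2 fun s => tendsto_pi_nhds.2 fun r => ?_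
  have h1 := tendsto_inner_center_mean (σ := σ) hC hα hN s r
  have h2 := (tendsto_noise_scale (σ := σ) hα hN s).mul (tendsto_inner_centers_div_sqrt C r s)
  have h3 := ((tendsto_noise_scale (σ := σ) hα hN s).mul (tendsto_noise_scale (σ := σ) hα hN r)).mul
    (tendsto_gram_div (π := fun D p => p.2) (fun D => measurePreserving_snd) s r)
  have e : C s r + σ s * (√(α s))⁻¹ * 0 + σ s * (√(α s))⁻¹ * (σ r * (√(α r))⁻¹) *
      (1 : Matrix (Fin T) (Fin T) ℝ) s r = limitGram C σ α s r := by
    rw [limitGram, Matrix.add_apply, Matrix.diagonal_apply, Matrix.one_apply]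
    split_ifs with h
    · subst h
      have h5 : (√(α s))⁻¹ * (√(α s))⁻¹ = (α s)⁻¹ := by
        rw [← mul_inv, Real.mul_self_sqrt (hα s).le]
      rw [div_eq_mul_inv]
      linear_combination σ s ^ 2 * h5
    · ring
  have h4 := (h1.add h2).add h3
  rw [e] at h4
  refine h4.congr' ?_
  filter_upwards [tendsto_fst_whp.eventually (eventually_gt_atTop 0)] with p hD
  have hD0 : (0 : ℝ) < p.1 := Nat.cast_pos.2 hD
  have hD' : √(p.1 : ℝ) ≠ 0 := Real.sqrt_ne_zero'.2 hD0
  have h7 : (p.1 : ℝ) = √p.1 * √p.1 := (Real.mul_self_sqrt hD0.le).symm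
  have h8 : gaussianMean C σ (N p.1) p.2 s =
    centers C p.2.1 s + (σ s * (√(N p.1 s))⁻¹) • p.2.2 s := rfl
  have h9 : (inner ℝ (p.2.2 s) (gaussianMean C σ (N p.1) p.2 r) : ℝ) =
      inner ℝ (centers C p.2.1 r) (p.2.2 s) +
        σ r * (√(N p.1 r))⁻¹ * inner ℝ (p.2.2 s) (p.2.2 r) := by
    rw [gaussianMean, inner_add_right, inner_smul_right, real_inner_comm]
  rw [Matrix.gram_apply, h8, inner_add_left, real_inner_smul_left, h9]
  have h10 : σ s * (√(N p.1 s))⁻¹ * √p.1 * (σ r * (√(N p.1 r))⁻¹ * √p.1) *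
      ((inner ℝ (p.2.2 s) (p.2.2 r) : ℝ) / p.1) =
      σ s * (√(N p.1 s))⁻¹ * (σ r * (√(N p.1 r))⁻¹) * (inner ℝ (p.2.2 s) (p.2.2 r) : ℝ) := by
    rw [div_eq_mul_inv]
    have : √(p.1 : ℝ) * √p.1 * (p.1 : ℝ)⁻¹ = 1 := by
      rw [← h7, mul_inv_cancel₀ hD0.ne']
    linear_combination (σ s * (√(N p.1 s))⁻¹ * (σ r * (√(N p.1 r))⁻¹) *
      (inner ℝ (p.2.2 s) (p.2.2 r) : ℝ)) * this
  have h11 : σ s * (√(N p.1 s))⁻¹ * √p.1 * ((inner ℝ (centers C p.2.1 r) (p.2.2 s) : ℝ) / √p.1) =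
      σ s * (√(N p.1 s))⁻¹ * (inner ℝ (centers C p.2.1 r) (p.2.2 s) : ℝ) := by
    rw [mul_assoc, mul_div_cancel₀ _ hD']
  rw [h10, h11]
  ring

theorem tendsto_oracleError (hC : C.PosSemidef) (hα : ∀ s, 0 < α s)
    (hK : (limitGram C σ α).det ≠ 0)
    (hN : ∀ s, Tendsto (fun D : ℕ => (N D s : ℝ) / (D : ℝ)) atTop (𝓝 (α s))) (t : Fin T) :
    Tendsto (fun p : Sample T =>
      oracleError (σ t) (centers C p.2.1 t) (gaussianMean C σ (N p.1) p.2))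
      (whp (pairLaw T)) (𝓝 (gaussianTail (√(C t ⬝ᵥ (limitGram C σ α)⁻¹ *ᵥ C t) / σ t))) := by
  have hG := tendsto_gram_mean (σ := σ) hC hα hN
  have hb : Tendsto (fun p : Sample T => fun s =>
      (inner ℝ (centers C p.2.1 t) (gaussianMean C σ (N p.1) p.2 s) : ℝ))
      (whp (pairLaw T)) (𝓝 (C t)) :=
    tendsto_pi_nhds.2 fun s => tendsto_inner_center_mean hC hα hN t s
  have hdet := ((Continuous.matrix_det continuous_id).tendsto (limitGram C σ α)).comp hG
  have hadj := ((Continuous.matrix_adjugate continuous_id).tendsto (limitGram C σ α)).comp hG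
  have hinv : Tendsto (fun p : Sample T => (Matrix.gram ℝ (gaussianMean C σ (N p.1) p.2))⁻¹)
      (whp (pairLaw T)) (𝓝 (limitGram C σ α)⁻¹) := by
    have h := (hdet.inv₀ hK).smul hadj
    simp only [Matrix.inv_def, Ring.inverse_eq_inv']
    exact h
  have hq : Tendsto (fun p : Sample T =>
      projNormSq (centers C p.2.1 t) (gaussianMean C σ (N p.1) p.2)) (whp (pairLaw T))
      (𝓝 (C t ⬝ᵥ (limitGram C σ α)⁻¹ *ᵥ C t)) := by
    have hc : Continuous fun x : (Fin T → ℝ) × Matrix (Fin T) (Fin T) ℝ =>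
        x.1 ⬝ᵥ x.2 *ᵥ x.1 :=
      continuous_fst.dotProduct (continuous_snd.matrix_mulVec continuous_fst)
    have h := (hc.tendsto (C t, (limitGram C σ α)⁻¹)).comp (hb.prodMk_nhds hinv)
    exact h
  have h1 := (continuous_gaussianTail.tendsto _).comp (hq.sqrt.div_const (σ t))
  refine h1.congr' ?_
  filter_upwards [hdet.eventually_ne hK] with p hp
  exact (if_neg hp).symm

theorem tendsto_linearError (hC : C.PosSemidef) (hσ : ∀ s, 0 < σ s) (hα : ∀ s, 0 < α s)
    (hN : ∀ s, Tendsto (fun D : ℕ => (N D s : ℝ) / (D : ℝ)) atTop (𝓝 (α s))) (t : Fin T)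
    (x : Fin T → ℝ) (hx : 0 < x ⬝ᵥ limitGram C σ α *ᵥ x) :
    Tendsto (fun p : Sample T =>
      linearError (σ t) (centers C p.2.1 t) (∑ s, x s • gaussianMean C σ (N p.1) p.2 s))
      (whp (pairLaw T))
      (𝓝 (gaussianTail (x ⬝ᵥ C t / (σ t * √(x ⬝ᵥ limitGram C σ α *ᵥ x))))) := by
  have hin : Tendsto (fun p : Sample T => (inner ℝ (centers C p.2.1 t)
      (∑ s, x s • gaussianMean C σ (N p.1) p.2 s) : ℝ)) (whp (pairLaw T)) (𝓝 (x ⬝ᵥ C t)) := by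
    simp only [inner_sum, inner_smul_right]
    exact tendsto_finsetSum _ fun s _ => (tendsto_inner_center_mean hC hα hN t s).const_mul _
  have hn : Tendsto (fun p : Sample T => ‖∑ s, x s • gaussianMean C σ (N p.1) p.2 s‖)
      (whp (pairLaw T)) (𝓝 (√(x ⬝ᵥ limitGram C σ α *ᵥ x))) := by
    have hc : Continuous fun G : Matrix (Fin T) (Fin T) ℝ => x ⬝ᵥ G *ᵥ x :=
      continuous_const.dotProduct (continuous_id.matrix_mulVec continuous_const)
    refine ((hc.tendsto _).comp (tendsto_gram_mean (σ := σ) hC hα hN)).sqrt.congr fun p => ?_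
    have h := Matrix.star_dotProduct_gram_mulVec (𝕜 := ℝ) (gaussianMean C σ (N p.1) p.2) x x
    rw [star_trivial, real_inner_self_eq_norm_sq] at h
    rw [Function.comp_apply, h, Real.sqrt_sq (norm_nonneg _)]
  have hpos : √(x ⬝ᵥ limitGram C σ α *ᵥ x) ≠ 0 := Real.sqrt_ne_zero'.2 hx
  have h1 := (continuous_gaussianTail.tendsto _).comp
    (hin.div (hn.const_mul (σ t)) (mul_ne_zero (hσ t).ne' hpos))
  refine h1.congr' ?_
  filter_upwards [hn.eventually_ne hpos] with p hp
  exact (if_neg (norm_ne_zero_iff.1 hp)).symm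

end Limits

/-! ### The two limits agree -/

section Algebra

variable {T : ℕ} {C : Matrix (Fin T) (Fin T) ℝ} {σ α : Fin T → ℝ}

theorem posDef_limitGram (hC : C.PosSemidef) (hσ : ∀ s, 0 < σ s) (hα : ∀ s, 0 < α s) :
    (limitGram C σ α).PosDef :=
  Matrix.PosDef.posSemidef_add hC
    (Matrix.PosDef.diagonal fun s => div_pos (pow_pos (hσ s) 2) (hα s))

/-- `1 + M D_α = S⁻¹ K S⁻¹ D_α`, where `S = diag(σ)` and `K = C + diag(σ² / α)`. -/
theorem one_add_signalMatrix_mul (hσ : ∀ s, 0 < σ s) (hα : ∀ s, 0 < α s) :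
    1 + signalMatrix C σ * Matrix.diagonal α =
      Matrix.diagonal (fun s => (σ s)⁻¹) * limitGram C σ α *
        Matrix.diagonal fun s => α s / σ s := by
  ext s r
  have h1 := (hσ s).ne'
  have h2 := (hα s).ne'
  simp only [signalMatrix, limitGram, Matrix.add_apply, Matrix.mul_diagonal, Matrix.diagonal_mul,
    Matrix.of_apply, Matrix.one_apply, Matrix.diagonal_apply]
  have h3 := (hσ r).ne'
  split_ifs with h
  · subst h
    field_simp
    ring
  · field_simp
    ring

theorem isUnit_det_one_add (hC : C.PosSemidef) (hσ : ∀ s, 0 < σ s) (hα : ∀ s, 0 < α s) :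
    IsUnit (1 + signalMatrix C σ * Matrix.diagonal α).det := by
  rw [one_add_signalMatrix_mul hσ hα, Matrix.det_mul, Matrix.det_mul, Matrix.det_diagonal,
    Matrix.det_diagonal, isUnit_iff_ne_zero]
  refine mul_ne_zero (mul_ne_zero ?_ (posDef_limitGram hC hσ hα).det_pos.ne') ?_
  · exact Finset.prod_ne_zero_iff.2 fun s _ => inv_ne_zero (hσ s).ne'
  · exact Finset.prod_ne_zero_iff.2 fun s _ => div_ne_zero (hα s).ne' (hσ s).ne'

/-- The coefficients of the class means in the combined mean of task `t`. -/
noncomputable def meanCoeff (C : Matrix (Fin T) (Fin T) ℝ) (σ α : Fin T → ℝ) (t s : Fin T) : ℝ :=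
  weights C σ α t s * (σ s)⁻¹

/-- The combined mean multiplied by `σ t` is the asymptotic projection of the center of
task `t` onto the span of the class means: its coefficients solve the limiting normal equations. -/
theorem limitGram_mulVec_meanCoeff (hC : C.PosSemidef) (hσ : ∀ s, 0 < σ s) (hα : ∀ s, 0 < α s)
    (t : Fin T) : limitGram C σ α *ᵥ meanCoeff C σ α t = (σ t)⁻¹ • C t := by
  have hsymm : (limitGram C σ α)ᵀ = limitGram C σ α :=
    (posDef_limitGram hC hσ hα).isHermitian
  have h1 : weights C σ α * (1 + signalMatrix C σ * Matrix.diagonal α) =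
      signalMatrix C σ * Matrix.diagonal α := by
    rw [weights, Matrix.mul_assoc, Matrix.nonsing_inv_mul _ (isUnit_det_one_add hC hσ hα),
      Matrix.mul_one]
  rw [one_add_signalMatrix_mul hσ hα, ← Matrix.mul_assoc] at h1
  rw [← hsymm, Matrix.mulVec_transpose]
  funext r
  have h2 := congrFun (congrFun h1 t) r
  rw [Matrix.mul_diagonal, Matrix.mul_diagonal, ← Matrix.mul_assoc, Matrix.mul_apply] at h2
  simp only [Matrix.mul_diagonal, signalMatrix, Matrix.of_apply] at h2
  have h3 : (meanCoeff C σ α t ᵥ* limitGram C σ α) r * (α r / σ r) =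
      C t r / (σ t * σ r) * α r := h2
  have h4 := (hσ r).ne'
  have h5 := (hα r).ne'
  have h6 := (hσ t).ne'
  rw [Pi.smul_apply, smul_eq_mul]
  field_simp at h3
  field_simp
  linarith

/-- `q_t = (A M)_{tt}`, from the push-through identity `(1 + M D_α)⁻¹ M = M (1 + D_α M)⁻¹`. -/
theorem overlap_eq (hC : C.PosSemidef) (hσ : ∀ s, 0 < σ s) (hα : ∀ s, 0 < α s) (t : Fin T) :
    overlap C σ α t = meanCoeff C σ α t ⬝ᵥ C t / σ t := by
  set M := signalMatrix C σ with hM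
  set A := Matrix.diagonal α with hA
  have hu : IsUnit (1 + M * A).det := isUnit_det_one_add hC hσ hα
  have hu' : IsUnit (1 + A * M).det := by rwa [Matrix.det_one_add_mul_comm]
  have h1 : (1 + M * A)⁻¹ * M = M * (1 + A * M)⁻¹ := by
    have h : M * (1 + A * M) = (1 + M * A) * M := by
      rw [Matrix.mul_add, Matrix.add_mul, Matrix.mul_one, Matrix.one_mul, Matrix.mul_assoc]
    calc (1 + M * A)⁻¹ * M = (1 + M * A)⁻¹ * (M * (1 + A * M)) * (1 + A * M)⁻¹ := by
          rw [Matrix.mul_assoc, Matrix.mul_assoc M, Matrix.mul_nonsing_inv _ hu', Matrix.mul_one]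
      _ = M * (1 + A * M)⁻¹ := by
          rw [h, ← Matrix.mul_assoc, Matrix.nonsing_inv_mul _ hu, Matrix.one_mul]
  have h2 : M - M * (1 + A * M)⁻¹ = weights C σ α * M := by
    have h3 : M * A * M * (1 + A * M)⁻¹ = M - M * (1 + A * M)⁻¹ := by
      have h : M * A * M = M * (1 + A * M) - M := by
        rw [Matrix.mul_add, Matrix.mul_one, add_sub_cancel_left, Matrix.mul_assoc]
      rw [h, Matrix.sub_mul, Matrix.mul_assoc, Matrix.mul_nonsing_inv _ hu', Matrix.mul_one]
    rw [weights, ← hM, ← hA, Matrix.mul_assoc, h1, ← Matrix.mul_assoc, h3]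
  rw [overlap, ← hM, ← hA, h2, Matrix.mul_apply, dotProduct, Finset.sum_div]
  refine Finset.sum_congr rfl fun s _ => ?_
  have hCs : C s t = C t s := hC.isHermitian.apply t s
  have := (hσ s).ne'
  have := (hσ t).ne'
  rw [hM, signalMatrix, Matrix.of_apply, hCs, meanCoeff]
  field_simp

theorem dotProduct_limitGram_mulVec_meanCoeff (hC : C.PosSemidef) (hσ : ∀ s, 0 < σ s)
    (hα : ∀ s, 0 < α s) (t : Fin T) :
    meanCoeff C σ α t ⬝ᵥ limitGram C σ α *ᵥ meanCoeff C σ α t = overlap C σ α t := by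
  rw [limitGram_mulVec_meanCoeff hC hσ hα, dotProduct_smul, overlap_eq hC hσ hα, smul_eq_mul,
    div_eq_inv_mul]

theorem overlap_pos (hC : C.PosSemidef) (hC1 : ∀ s, C s s = 1) (hσ : ∀ s, 0 < σ s)
    (hα : ∀ s, 0 < α s) (t : Fin T) : 0 < overlap C σ α t := by
  rw [← dotProduct_limitGram_mulVec_meanCoeff hC hσ hα]
  refine (posDef_limitGram hC hσ hα).dotProduct_mulVec_pos fun (h0 : meanCoeff C σ α t = 0) => ?_
  have h := congrFun (limitGram_mulVec_meanCoeff hC hσ hα t) t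
  rw [h0, Matrix.mulVec_zero, Pi.zero_apply, Pi.smul_apply, hC1, smul_eq_mul, mul_one] at h
  exact inv_ne_zero (hσ t).ne' h.symm

/-- The limiting signal-to-noise ratio of the oracle. -/
theorem sqrt_dotProduct_inv_limitGram (hC : C.PosSemidef) (hσ : ∀ s, 0 < σ s)
    (hα : ∀ s, 0 < α s) (t : Fin T) :
    √(C t ⬝ᵥ (limitGram C σ α)⁻¹ *ᵥ C t) / σ t = √(overlap C σ α t) := by
  have hK : IsUnit (limitGram C σ α).det :=
    isUnit_iff_ne_zero.2 (posDef_limitGram hC hσ hα).det_pos.ne'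
  have h1 : (limitGram C σ α)⁻¹ *ᵥ C t = σ t • meanCoeff C σ α t := by
    have h2 : C t = limitGram C σ α *ᵥ (σ t • meanCoeff C σ α t) := by
      rw [Matrix.mulVec_smul, limitGram_mulVec_meanCoeff hC hσ hα, smul_smul,
        mul_inv_cancel₀ (hσ t).ne', one_smul]
    conv_lhs => rw [h2, Matrix.mulVec_mulVec, Matrix.nonsing_inv_mul _ hK, Matrix.one_mulVec]
  have h3 : C t ⬝ᵥ (limitGram C σ α)⁻¹ *ᵥ C t = σ t ^ 2 * overlap C σ α t := by
    rw [h1, dotProduct_smul, dotProduct_comm, overlap_eq hC hσ hα, smul_eq_mul]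
    have := (hσ t).ne'
    field_simp
  rw [h3, Real.sqrt_mul (sq_nonneg _), Real.sqrt_sq (hσ t).le,
    mul_div_cancel_left₀ _ (hσ t).ne']

/-- The limiting signal-to-noise ratio of the algorithm. -/
theorem meanCoeff_dotProduct_div (hC : C.PosSemidef) (hσ : ∀ s, 0 < σ s)
    (hα : ∀ s, 0 < α s) (t : Fin T) :
    meanCoeff C σ α t ⬝ᵥ C t /
      (σ t * √(meanCoeff C σ α t ⬝ᵥ limitGram C σ α *ᵥ meanCoeff C σ α t)) =
      √(overlap C σ α t) := by
  rw [dotProduct_limitGram_mulVec_meanCoeff hC hσ hα, ← div_div, ← overlap_eq hC hσ hα,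
    Real.div_sqrt]

end Algebra

/-! ### Squeezing the risks -/

theorem oracleError_le_one {T D : ℕ} (σ : ℝ) (u : Pt D) (y : Fin T → Pt D) :
    oracleError σ u y ≤ 1 := by
  unfold oracleError
  split_ifs
  · exact zero_le_one
  · exact gaussianTail_le_one _

theorem linearError_le_one {D : ℕ} (σ : ℝ) (u w : Pt D) : linearError σ u w ≤ 1 := by
  unfold linearError
  split_ifs
  · exact le_rfl
  · exact gaussianTail_le_one _

theorem toReal_gaussianTail (x : ℝ) :
    (gaussianTail x).toReal = 1 - cdf (gaussianReal 0 1) x := by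
  rw [gaussianTail_eq, ENNReal.toReal_ofReal (sub_nonneg.2 (cdf_le_one _ _))]

end MultitaskGM

theorem mainTheorem2 {T : ℕ} (C : Matrix (Fin T) (Fin T) ℝ) (hC : C.PosSemidef)
    (hC1 : ∀ s, C s s = 1) (σ α : Fin T → ℝ) (hσ : ∀ s, 0 < σ s) (hα : ∀ s, 0 < α s)
    (N : ℕ → Fin T → ℕ)
    (hN : ∀ s, Tendsto (fun D : ℕ => (N D s : ℝ) / (D : ℝ)) atTop (𝓝 (α s))) (t : Fin T) :
    Tendsto (fun D => MultitaskGM.bayesRisk C σ (N D) D t) atTop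
        (𝓝 (1 - cdf (gaussianReal 0 1) (√(MultitaskGM.overlap C σ α t)))) ∧
      (∀ D, Measurable (MultitaskGM.algorithm C σ α (N D) D t)) ∧
      Tendsto (fun D => MultitaskGM.risk C σ (N D) D t (MultitaskGM.algorithm C σ α (N D) D t))
        atTop (𝓝 (1 - cdf (gaussianReal 0 1) (√(MultitaskGM.overlap C σ α t)))) := by
  open MultitaskGM in
  -- the class mean of a task without training points is a junk value
  have hpos : ∀ᶠ D in atTop, ∀ s, N D s ≠ 0 := by
    refine eventually_all.2 fun s => ?_
    filter_upwards [(hN s).eventually_ne (hα s).ne'] with D hD h0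
    exact hD (by rw [h0, Nat.cast_zero, zero_div])
  have hlow := tendsto_lintegral_of_whp (fun p => oracleError_le_one _ _ _)
    (gaussianTail_le_one _) (tendsto_oracleError (σ := σ) hC hα
      (posDef_limitGram hC hσ hα).det_pos.ne' hN t)
  have hq : 0 < meanCoeff C σ α t ⬝ᵥ limitGram C σ α *ᵥ meanCoeff C σ α t := by
    rw [dotProduct_limitGram_mulVec_meanCoeff hC hσ hα]
    exact overlap_pos hC hC1 hσ hα t
  have hup := tendsto_lintegral_of_whp (fun p => linearError_le_one _ _ _)
    (gaussianTail_le_one _) (tendsto_linearError hC hσ hα hN t (meanCoeff C σ α t) hq)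
  rw [sqrt_dotProduct_inv_limitGram hC hσ hα] at hlow
  rw [meanCoeff_dotProduct_div hC hσ hα] at hup
  have hfin : gaussianTail (√(overlap C σ α t)) ≠ ⊤ :=
    ((gaussianTail_le_one _).trans_lt ENNReal.one_lt_top).ne
  have hlow' := (ENNReal.tendsto_toReal hfin).comp hlow
  have hup' := (ENNReal.tendsto_toReal hfin).comp hup
  rw [toReal_gaussianTail] at hlow' hup'
  have hnonneg : ∀ D f, 0 ≤ risk C σ (N D) D t f := fun D f => measureReal_nonneg
  have hle : ∀ D, bayesRisk C σ (N D) D t ≤ risk C σ (N D) D t (algorithm C σ α (N D) D t) :=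
    fun D => ciInf_le (f := fun f : {f : Obs T (N D) D → ℝ // Measurable f} =>
      risk C σ (N D) D t f) ⟨0, by rintro _ ⟨f, rfl⟩; exact hnonneg D f⟩
      ⟨_, measurable_algorithm C σ α (N D) t⟩
  have hge : ∀ᶠ D in atTop, (∫⁻ p, oracleError (σ t) (centers C p.1 t)
      (gaussianMean C σ (N D) p) ∂pairLaw T D).toReal ≤ bayesRisk C σ (N D) D t := by
    filter_upwards [hpos] with D hD
    have : Nonempty {f : Obs T (N D) D → ℝ // Measurable f} := ⟨⟨_, measurable_const (a := 0)⟩⟩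
    refine le_ciInf fun f => ?_
    exact ENNReal.toReal_le_of_le_ofReal (hnonneg D _)
      (lintegral_oracleError_le_risk hD C hσ t f.2)
  have hle' : ∀ᶠ D in atTop, risk C σ (N D) D t (algorithm C σ α (N D) D t) ≤
      (∫⁻ p, linearError (σ t) (centers C p.1 t)
        (∑ s, meanCoeff C σ α t s • gaussianMean C σ (N D) p s) ∂pairLaw T D).toReal := by
    filter_upwards [hpos] with D hD
    refine (ENNReal.ofReal_le_iff_le_toReal ?_).1 (risk_algorithm_le hD C hσ α t)
    refine ne_top_of_le_ne_top ENNReal.one_ne_top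
      ((lintegral_mono fun p => linearError_le_one _ _ _).trans ?_)
    rw [lintegral_const, measure_univ, mul_one]
  refine ⟨?_, fun D => measurable_algorithm C σ α (N D) t, ?_⟩
  · refine tendsto_of_tendsto_of_tendsto_of_le_of_le' hlow' hup' hge ?_
    filter_upwards [hle'] with D hD
    exact (hle D).trans hD
  · refine tendsto_of_tendsto_of_tendsto_of_le_of_le' hlow' hup' ?_ hle'
    filter_upwards [hge] with D hD
    exact hD.trans (hle D)
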